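/- For $n\ge 1$ and $a_1,a_2,a_3,b\in\mathbb{Z}_n=\mathbb{Z}/n\mathbb{Z}$, let $\mathrm{eq}(a_1,a_2,a_3,b)$ denote the equation $a_1x_1+a_2x_2+a_3x_3=b$ over $\mathbb{Z}_n$. An exact $r$-coloring of $\mathbb{Z}_n$ is a surjective map $c:\mathbb{Z}_n\to\{1,\dots,r\}$, and a rainbow solution for $c$ is an ordered triple $(s_1,s_2,s_3)$ with $a_1s_1+a_2s_2+a_3s_3=b$ and $c(s_1),c(s_2),c(s_3)$ pairwise distinct. The rainbow number $\mathrm{rb}(\mathbb{Z}_n,\mathrm{eq}(a_1,a_2,a_3,b))$ is the smallest positive integer $r$ such that every exact $r$-coloring of $\mathbb{Z}_n$ has a rainbow solution (so it equals $n+1$ if exact $n$-colorings have none). **Theorem.** Let $p\ge 5$ be prime and let $a_1,a_2,a_3,b\in\mathbb{Z}_p$ with $a_1a_2a_3\in\mathbb{Z}_p^*$ and $a_i\ne a_j$ for some $i\neq j$. Put $d_1=-a_3a_1^{-1}$, $d_2=-a_2a_1^{-1}$, $d_3=-a_1a_2^{-1}$, $d_4=-a_3a_2^{-1}$, $d_5=-a_1a_3^{-1}$,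 $d_6=-a_2a_3^{-1}$, and let $\langle d_1,\dots,d_6\rangle$ be the subgroup of $\mathbb{Z}_p^*$ that they generate. Then $$\mathrm{rb}(\mathbb{Z}_p,\mathrm{eq}(a_1,a_2,a_3,b))=\begin{cases}3 & \text{if } |\langle d_1,\dots,d_6\rangle|=p-1 \text{ or } a_1+a_2+a_3=0\neq b,\\ 4 & \text{otherwise.}\end{cases}$$ -/

import Mathlib

/-- The ordered triple `(s₁, s₂, s₃)` is a solution of `a₁ x₁ + a₂ x₂ + a₃ x₃ = b` in `ℤ/nℤ`. -/
def IsSolution {n : ℕ} (a₁ a₂ a₃ b : ZMod n) (s₁ s₂ s₃ : ZMod n) : Prop :=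
  a₁ * s₁ + a₂ * s₂ + a₃ * s₃ = b

/-- The coloring `c` of `ℤ/nℤ` has a rainbow solution of `a₁ x₁ + a₂ x₂ + a₃ x₃ = b`: a solution
whose three members have pairwise distinct colors. -/
def HasRainbowSolution {n r : ℕ} (a₁ a₂ a₃ b : ZMod n) (c : ZMod n → Fin r) : Prop :=
  ∃ s₁ s₂ s₃ : ZMod n, IsSolution a₁ a₂ a₃ b s₁ s₂ s₃ ∧
    c s₁ ≠ c s₂ ∧ c s₁ ≠ c s₃ ∧ c s₂ ≠ c s₃

/-- The rainbow number of `ℤ/nℤ` for `a₁ x₁ + a₂ x₂ + a₃ x₃ = b`: the least positive `r` such that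
every exact (that is, surjective) `r`-coloring of `ℤ/nℤ` has a rainbow solution. For `n ≥ 1` there
is no exact `(n + 1)`-coloring, so `r = n + 1` always qualifies, and the value is `n + 1` exactly
when the exact `n`-colorings have no rainbow solution, as the usual convention demands. -/
noncomputable def rainbowNumber {n : ℕ} (a₁ a₂ a₃ b : ZMod n) : ℕ :=
  sInf {r : ℕ | 0 < r ∧
    ∀ c : ZMod n → Fin r, Function.Surjective c → HasRainbowSolution a₁ a₂ a₃ b c}

/-- The multiplicative subgroup of `(ℤ/nℤ)ˣ` generated by the six ratios `-a_j a_k⁻¹`, `j ≠ k`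
(each of which is a unit when `a₁, a₂, a₃` are units). -/
def ratioSubgroup {n : ℕ} (a₁ a₂ a₃ : ZMod n) : Subgroup (ZMod n)ˣ :=
  Subgroup.closure {u : (ZMod n)ˣ | (u : ZMod n) ∈
    ({-a₃ * a₁⁻¹, -a₂ * a₁⁻¹, -a₁ * a₂⁻¹, -a₃ * a₂⁻¹, -a₁ * a₃⁻¹, -a₂ * a₃⁻¹} : Set (ZMod n))}

/-! The core is a structure statement: if the coefficients are not all equal and a 3-colouring with
nonempty classes has no rainbow solution, then exactly one class is a singleton `{u}`, and `u` is a
constant solution, `(a₁ + a₂ + a₃) u = b`. Given this, each of the other two classes, moved by `-u`,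
is closed under multiplication by every ratio `-a_j / a_i`, hence is a union of cosets of the
subgroup these ratios generate. Both classes are nonempty, so the subgroup is proper. Conversely, a
constant solution and a proper subgroup give a rainbow-free colouring: `u`, `u` plus the subgroup,
and the rest. A constant solution is missing exactly when `a₁ + a₂ + a₃ = 0 ≠ b`. Four colours
always suffice: merging two of them leaves exactly one singleton among the other two, and this
cannot hold for all pairs.

That three classes with at least two elements each are impossible is inverse additive combinatorics.
For a rainbow-free partition `A, B, C` the set `a_i A + a_j B` misses the reflection of `a_k C`, so
`#(a_i A + a_j B) ≤ #A + #B`, one more than the Cauchy–Davenport minimum. The sets are studied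
through their number of runs along a step `d`. Replacing one set by its union with a translate, and
another by its intersection with the opposite translate, preserves the avoidance, so
Cauchy–Davenport shows that the numbers of runs of two classes, along steps in the ratio of their
coefficients, differ by little.

Minimal extremal summands, in the manner of Hamidoune's isoperimetric method, give a step along
which one class has at most two runs (`exists_runs_le_one`, `exists_runs_le_two`). The exchange
spreads this to the other classes and to the steps multiplied by `a_k / a_i`. A set with few runs
along two steps forces the quotient of the steps to be small (`small_of_runs_le`); applied to a
ratio and its square this leaves only `a_i² = a_j²`. Coefficients equal up to sign are excluded by
`false_of_sq_eq`. Classes of sizes 2, 2 and 3, 3 need separate arguments, and `p = 7, 11, 13` are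
settled by a search. -/

open Finset Pointwise

/-- No element of `X + Y + Z` equals `b`. -/
def SumAvoids {p : ℕ} (b : ZMod p) (X Y Z : Finset (ZMod p)) : Prop :=
  ∀ x ∈ X, ∀ y ∈ Y, ∀ z ∈ Z, x + y + z ≠ b

/-- The number of maximal runs of `S` along the step `d`. -/
def runs {p : ℕ} (S : Finset (ZMod p)) (d : ZMod p) : ℕ := #{x ∈ S | x + d ∉ S}

/-- The elements of `S` whose translate by `d` is again in `S`. -/
def inner' {p : ℕ} (S : Finset (ZMod p)) (d : ZMod p) : Finset (ZMod p) := {x ∈ S | x + d ∈ S}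

/-- The union of `S` and its translate by `d`. -/
def outer {p : ℕ} (S : Finset (ZMod p)) (d : ZMod p) : Finset (ZMod p) := S ∪ S.image (· + d)

/-! ### Runs along a step and the exchange of translates -/

section

variable {p : ℕ} {b d : ZMod p} {X Y Z S T : Finset (ZMod p)}

theorem SumAvoids.rotate (h : SumAvoids b X Y Z) : SumAvoids b Y Z X :=
  fun y hy z hz x hx e => h x hx y hy z hz (by rw [← e]; ring)

theorem SumAvoids.swap (h : SumAvoids b X Y Z) : SumAvoids b Y X Z :=
  fun y hy x hx z hz e => h x hx y hy z hz (by rw [← e]; ring)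

/-- The sum `(x + d) + y + z` equals `x + y + (z + d)`, so a translation is traded between two
summands. All comparisons of runs rest on this exchange. -/
theorem SumAvoids.outer_inner (h : SumAvoids b X Y Z) (d : ZMod p) :
    SumAvoids b (outer X d) Y (inner' Z d) := by
  intro x hx y hy z hz e
  simp only [inner', mem_filter] at hz
  simp only [outer, mem_union, mem_image] at hx
  rcases hx with hx | ⟨x, hx, rfl⟩
  · exact h x hx y hy z hz.1 e
  · exact h x hx y hy (z + d) hz.2 (by rw [← e]; ring)

theorem card_inner_add_runs (S : Finset (ZMod p)) (d : ZMod p) :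
    #(inner' S d) + runs S d = #S := by
  unfold inner' runs
  exact card_filter_add_card_filter_not _

theorem card_outer (S : Finset (ZMod p)) (d : ZMod p) : #(outer S d) = #S + runs S d := by
  have h1 : outer S d = S ∪ ({x ∈ S | x + d ∉ S}).image (· + d) := by
    ext x
    simp only [outer, mem_union, mem_image, mem_filter]
    constructor
    · rintro (h | ⟨y, hy, rfl⟩)
      · exact Or.inl h
      · by_cases hh : y + d ∈ S
        · exact Or.inl hh
        · exact Or.inr ⟨y, ⟨hy, hh⟩, rfl⟩
    · rintro (h | ⟨y, hy, rfl⟩)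
      · exact Or.inl h
      · exact Or.inr ⟨y, hy.1, rfl⟩
  rw [h1, card_union_of_disjoint, card_image_of_injective _ (add_left_injective d)]
  · rfl
  · rw [disjoint_left]
    intro x hx hx'
    simp only [mem_image, mem_filter] at hx'
    obtain ⟨y, hy, rfl⟩ := hx'
    exact hy.2 hx

theorem subset_outer : S ⊆ outer S d := subset_union_left

theorem Finset.Nonempty.outer (h : S.Nonempty) : (outer S d).Nonempty := h.mono subset_outer

theorem inner_subset : inner' S d ⊆ S := filter_subset _ _

theorem outer_union (S T : Finset (ZMod p)) (d : ZMod p) :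
    outer (S ∪ T) d = outer S d ∪ outer T d := by
  ext x; simp only [outer, image_union, mem_union]; tauto

theorem outer_inter_subset (S T : Finset (ZMod p)) (d : ZMod p) :
    outer (S ∩ T) d ⊆ outer S d ∩ outer T d := by
  intro x
  simp only [outer, mem_union, mem_image, mem_inter]
  rintro (h | ⟨y, hy, rfl⟩)
  · tauto
  · exact ⟨Or.inr ⟨y, hy.1, rfl⟩, Or.inr ⟨y, hy.2, rfl⟩⟩

/-- Submodularity: adjoining the translate commutes with unions and can only shrink under
intersections. -/
theorem runs_union_add_runs_inter (S T : Finset (ZMod p)) (d : ZMod p) :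
    runs (S ∪ T) d + runs (S ∩ T) d ≤ runs S d + runs T d := by
  have h1 := card_outer (S ∪ T) d
  have h2 := card_outer (S ∩ T) d
  have h3 := card_outer S d
  have h4 := card_outer T d
  rw [outer_union] at h1
  have h5 := card_union_add_card_inter (outer S d) (outer T d)
  have h6 := card_le_card (outer_inter_subset S T d)
  have h7 := card_union_add_card_inter S T
  omega

theorem runs_image_add (S : Finset (ZMod p)) (t d : ZMod p) :
    runs (S.image (· + t)) d = runs S d := by
  unfold runs
  rw [filter_image, card_image_of_injective _ (add_left_injective t)]
  congr 1
  ext x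
  simp only [mem_filter, mem_image]
  refine and_congr_right fun _ => not_congr ⟨?_, fun h => ⟨_, h, by ring⟩⟩
  rintro ⟨y, hy, e⟩
  have : y = x + d := by linear_combination e
  rwa [← this]

theorem runs_neg (S : Finset (ZMod p)) (d : ZMod p) : runs S (-d) = runs S d := by
  have h1 := card_inner_add_runs S d
  have h2 := card_inner_add_runs S (-d)
  have h3 : inner' S (-d) = (inner' S d).image (· + d) := by
    ext x
    simp only [inner', mem_filter, mem_image]
    constructor
    · rintro ⟨h, h'⟩
      exact ⟨x + -d, ⟨h', by simpa using h⟩, by simp⟩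
    · rintro ⟨y, ⟨h, h'⟩, rfl⟩
      exact ⟨h', by simpa using h⟩
  rw [h3, card_image_of_injective _ (add_left_injective d)] at h2
  omega

theorem runs_le_card (S : Finset (ZMod p)) (d : ZMod p) : runs S d ≤ #S := card_filter_le _ _

variable [Fact p.Prime]

/-- An exit from the complement along `d` is, read backwards, an exit from `S` along `-d`. -/
theorem runs_compl (S : Finset (ZMod p)) (d : ZMod p) : runs Sᶜ d = runs S d := by
  rw [← runs_neg S]
  unfold runs
  rw [← card_image_of_injective _ (add_left_injective d)]
  congr 1
  ext x
  simp only [mem_filter, mem_image, mem_compl, not_not]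
  constructor
  · rintro ⟨y, ⟨h, h'⟩, rfl⟩
    exact ⟨h', by simpa using h⟩
  · rintro ⟨h, h'⟩
    exact ⟨x + -d, ⟨h', by simpa using h⟩, by simp⟩

theorem runs_image_mul (S : Finset (ZMod p)) {a : ZMod p} (ha : a ≠ 0) (d : ZMod p) :
    runs (S.image (a * ·)) (a * d) = runs S d := by
  have hinj : Function.Injective (a * · : ZMod p → ZMod p) := mul_right_injective₀ ha
  unfold runs
  rw [filter_image, card_image_of_injective _ hinj]
  congr 1
  ext x
  simp only [mem_filter, mem_image]
  refine and_congr_right fun _ => not_congr ⟨?_, fun h => ⟨_, h, by ring⟩⟩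
  rintro ⟨y, hy, e⟩
  have : y = x + d := hinj (by simp only [e]; ring)
  rwa [← this]

/-- A set closed under a nonzero translation is empty or everything. -/
theorem eq_univ_of_forall_add_mem (hd : d ≠ 0) (hS : S.Nonempty) (h : ∀ x ∈ S, x + d ∈ S) :
    S = univ := by
  obtain ⟨x, hx⟩ := hS
  have key : ∀ n : ℕ, x + n * d ∈ S := by
    intro n
    induction n with
    | zero => simpa using hx
    | succ n ih => have := h _ ih; push_cast; convert this using 1; ring
  refine eq_univ_of_forall fun y => ?_
  have := key ((y - x) * d⁻¹).val
  rw [ZMod.natCast_zmod_val, mul_assoc, inv_mul_cancel₀ hd] at this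
  simpa using this

theorem one_le_runs (hd : d ≠ 0) (hS : S.Nonempty) (hS' : S ≠ univ) : 1 ≤ runs S d := by
  rw [Nat.one_le_iff_ne_zero]
  intro h
  refine hS' (eq_univ_of_forall_add_mem hd hS fun x hx => ?_)
  by_contra hxd
  unfold runs at h
  rw [card_eq_zero] at h
  exact notMem_empty x (h ▸ mem_filter.2 ⟨hx, hxd⟩)

theorem SumAvoids.card_add_le (h : SumAvoids b X Y Z) : #(X + Y) + #Z ≤ p := by
  have h1 : Disjoint (X + Y) (Z.image (b - ·)) := by
    rw [disjoint_left]
    intro s hs hs'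
    obtain ⟨x, hx, y, hy, rfl⟩ := mem_add.1 hs
    obtain ⟨z, hz, e⟩ := mem_image.1 hs'
    exact h x hx y hy z hz (by rw [← e]; ring)
  have h2 := card_le_univ ((X + Y) ∪ (Z.image (b - ·)))
  rwa [card_union_of_disjoint h1, card_image_of_injective _ sub_right_injective, ZMod.card] at h2

theorem SumAvoids.card_le (h : SumAvoids b X Y Z) (hX : X.Nonempty) (hY : Y.Nonempty)
    (hZ : Z.Nonempty) : #X + #Y + #Z ≤ p + 1 := by
  have h1 := h.card_add_le
  have h2 := ZMod.cauchy_davenport (Fact.out : p.Prime) hX hY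
  have := hX.card_pos
  have := hZ.card_pos
  rcases min_le_iff.1 h2 with h2 | h2 <;> omega

/-- Cauchy–Davenport after the exchange: `X` gains as many elements as it has runs and `Z` loses as
many as it has runs. The hypothesis on `Z` keeps what is left of it nonempty. -/
theorem SumAvoids.runs_le (h : SumAvoids b X Y Z) (hX : X.Nonempty) (hY : Y.Nonempty)
    (d : ZMod p) (hZ : runs Z d < #Z) : #X + runs X d + #Y + #Z ≤ p + 1 + runs Z d := by
  have h1 := card_inner_add_runs Z d
  have h2 := (h.outer_inner d).card_le hX.outer hY (card_pos.1 (by omega))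
  rw [card_outer] at h2
  omega

end

/-- Distinct translates of `M` have at most one common point. -/
def TranslatesMeetOnce {p : ℕ} (M : Finset (ZMod p)) : Prop :=
  ∀ t : ZMod p, t ≠ 0 → #(M ∩ M.image (· + t)) ≤ 1

/-! ### Minimal extremal summands -/

section

variable {p : ℕ} {C M Y Z J W : Finset (ZMod p)}

theorem TranslatesMeetOnce.card_inter_le (h : TranslatesMeetOnce M) {s t : ZMod p} (hst : s ≠ t) :
    #(M.image (· + s) ∩ M.image (· + t)) ≤ 1 := by
  have h1 : M.image (· + s) ∩ M.image (· + t)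
      = (M ∩ M.image (· + (t - s))).image (· + s) := by
    rw [image_inter _ _ (add_left_injective s), image_image]
    congr 2
    ext x; simp only [Function.comp]; ring
  rw [h1]
  exact card_image_le.trans (h _ (sub_ne_zero.2 hst.symm))

theorem card_image_add (S : Finset (ZMod p)) (t : ZMod p) : #(S.image (· + t)) = #S :=
  card_image_of_injective _ (add_left_injective t)

theorem image_add_right_eq (t : ZMod p) (S : Finset (ZMod p)) : S + {t} = S.image (· + t) :=
  image₂_singleton_right

theorem image_add_add (S C : Finset (ZMod p)) (t : ZMod p) :
    S.image (· + t) + C = (S + C).image (· + t) := by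
  rw [← image_add_right_eq t S, ← image_add_right_eq t (S + C), add_right_comm]

/-- Submodularity of `X ↦ #(X + C)`, the source of all intersection arguments below. -/
theorem card_union_add_le (X Y C : Finset (ZMod p)) :
    #((X ∪ Y) + C) + #((X ∩ Y) + C) ≤ #(X + C) + #(Y + C) := by
  rw [union_add, ← card_union_add_card_inter (X + C)]
  have := card_le_card (inter_add_subset (s₁ := X) (s₂ := Y) (t := C))
  omega

variable [Fact p.Prime]

/-- A second moment bound for sums with a set whose translates meet at most once. -/
theorem TranslatesMeetOnce.card_add_bound (h : TranslatesMeetOnce M) (Z : Finset (ZMod p))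
    (a : ℕ) :
    (2 * a + 1) * (#M * #Z) + #Z ≤ #M * #Z + #Z * #Z + a * (a + 1) * #(M + Z) := by
  set r : ZMod p → ℕ := fun x => #{z ∈ Z | x - z ∈ M} with hr
  have hcnt : ∀ z ∈ Z, #{x ∈ M + Z | x - z ∈ M} = #M := by
    intro z hz
    rw [← card_image_add M z]
    congr 1
    ext x
    simp only [mem_filter, mem_image]
    constructor
    · rintro ⟨_, h⟩; exact ⟨_, h, sub_add_cancel _ _⟩
    · rintro ⟨y, hy, rfl⟩; exact ⟨add_mem_add hy hz, by simpa using hy⟩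
  have h1 : ∑ x ∈ M + Z, r x = #M * #Z := by
    simp only [hr, card_filter]
    rw [sum_comm, mul_comm, ← smul_eq_mul, ← sum_const]
    exact sum_congr rfl fun z hz => by rw [← card_filter, hcnt z hz]
  have h2 : ∑ x ∈ M + Z, r x * r x ≤ #M * #Z + (#Z * #Z - #Z) := by
    have : ∑ x ∈ M + Z, r x * r x
        = ∑ q ∈ Z ×ˢ Z, #{x ∈ M + Z | x - q.1 ∈ M ∧ x - q.2 ∈ M} := by
      simp only [hr, card_filter]
      rw [sum_comm' (t' := M + Z) (s' := fun _ => Z ×ˢ Z) (by simp)]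
      refine sum_congr rfl fun x _ => ?_
      rw [sum_mul_sum, sum_product]
      refine sum_congr rfl fun z _ => sum_congr rfl fun z' _ => ?_
      split_ifs <;> simp_all
    rw [this, ← diag_union_offDiag, sum_union (disjoint_diag_offDiag Z), sum_diag]
    refine Nat.add_le_add ?_ ?_
    · rw [mul_comm, ← smul_eq_mul, ← sum_const]
      refine sum_le_sum fun z hz => ?_
      simp only [and_self, hcnt z hz, le_refl]
    · rw [← offDiag_card, card_eq_sum_ones]
      refine sum_le_sum fun q hq => ?_
      rw [mem_offDiag] at hq
      refine le_trans (card_le_card fun x hx => ?_) (h.card_inter_le hq.2.2)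
      rw [mem_filter] at hx
      simp only [mem_inter, mem_image]
      exact ⟨⟨_, hx.2.1, by ring⟩, ⟨_, hx.2.2, by ring⟩⟩
  -- Pointwise this is `(r - a) (r - a - 1) ≥ 0`, valid for integers.
  have h3 : (2 * a + 1) * ∑ x ∈ M + Z, r x
      ≤ ∑ x ∈ M + Z, r x * r x + a * (a + 1) * #(M + Z) := by
    rw [mul_sum, card_eq_sum_ones, mul_sum, ← sum_add_distrib]
    refine sum_le_sum fun x _ => ?_
    rcases Nat.lt_or_ge (r x) (a + 1) with hx | hx
    · obtain ⟨k, hk⟩ := Nat.exists_eq_add_of_le (Nat.lt_succ_iff.1 hx)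
      rw [hk]; nlinarith
    · obtain ⟨k, hk⟩ := Nat.exists_eq_add_of_le hx
      rw [hk]; nlinarith [Nat.zero_le (k * k)]
  rw [h1] at h3
  have : #Z ≤ #Z * #Z := Nat.le_mul_self _
  omega

/-- For `j, y ∈ M` the translates `M + j` and `M + y` share `j + y`, hence nothing else. -/
theorem TranslatesMeetOnce.inter_eq (h : TranslatesMeetOnce M) (hJ : J ⊆ M) {y : ZMod p}
    (hy : y ∈ M) (hyJ : y ∉ J) : (M + J) ∩ M.image (· + y) = J.image (· + y) := by
  ext x
  simp only [mem_inter, mem_image]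
  constructor
  · rintro ⟨hx, m, hm, rfl⟩
    obtain ⟨m', hm', j, hj, e⟩ := mem_add.1 hx
    have hjy : j ≠ y := fun e => hyJ (e ▸ hj)
    have := card_le_one.1 (h.card_inter_le hjy) (m + y)
      (mem_inter.2 ⟨mem_image.2 ⟨m', hm', e⟩, mem_image.2 ⟨m, hm, rfl⟩⟩) (j + y)
      (mem_inter.2 ⟨mem_image.2 ⟨y, hy, add_comm _ _⟩, mem_image.2 ⟨j, hJ hj, rfl⟩⟩)
    exact ⟨j, hj, this.symm⟩
  · rintro ⟨j, hj, rfl⟩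
    exact ⟨mem_add.2 ⟨y, hy, j, hj, add_comm _ _⟩, j, hJ hj, rfl⟩

/-- The hypotheses on `M` shared by the lemmas on extremal summands: sums with `C` have excess at
least `θ`, the set `M` attains it, and no smaller part of `M` does. -/
structure IsExtremalSummand {p : ℕ} (C : Finset (ZMod p)) (θ : ℤ) (M : Finset (ZMod p)) :
    Prop where
  nonempty : C.Nonempty
  le_excess : ∀ Y : Finset (ZMod p), 2 ≤ #Y → #(Y + C) + 2 ≤ p → (#Y + #C + θ : ℤ) ≤ #(Y + C)
  two_le : 2 ≤ #M
  excess : (#(M + C) : ℤ) ≤ #M + #C + θ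
  minimal : ∀ W ⊂ M, 2 ≤ #W → (#W + #C + θ + 1 : ℤ) ≤ #(W + C)
  small : (2 * #M + #C + θ : ℤ) ≤ p

theorem IsExtremalSummand.minimal' {θ : ℤ} (h : IsExtremalSummand C θ M) (t : ZMod p) (hW : W ⊂ M) (h2 : 2 ≤ #W) :
    (#W + #C + θ + 1 : ℤ) ≤ #(W.image (· + t) + C) := by
  rw [image_add_add, card_image_add]
  exact h.minimal W hW h2

/-- If `M` and `M + t` shared two points, their intersection would be a proper part of `M`, of
excess above `θ`. By submodularity the union would have excess below `θ`; `small` keeps the union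
within the range of `le_excess`. -/
theorem IsExtremalSummand.translatesMeetOnce {θ : ℤ} (h : IsExtremalSummand C θ M) : TranslatesMeetOnce M := by
  intro t ht
  by_contra! h2
  have hss : M ∩ M.image (· + t) ⊂ M := by
    refine inter_subset_left.ssubset_of_ne fun e => ?_
    have hM : M.Nonempty := card_pos.1 (by have := h.two_le; omega)
    have hsub : M ⊆ M.image (· + t) := inter_eq_left.1 e
    have heq : M = M.image (· + t) := eq_of_subset_of_card_le hsub (card_image_add M t).le
    have huniv : M = univ := eq_univ_of_forall_add_mem ht hM fun x hx => by
      rw [heq]; exact mem_image_of_mem _ hx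
    have h3 := h.minimal
    have hle := card_le_card (subset_univ (M + C))
    rw [card_univ, ZMod.card] at hle
    have hMC : M + C = univ := by
      rw [huniv]
      obtain ⟨c, hc⟩ := h.nonempty
      exact eq_univ_of_forall fun x => mem_add.2 ⟨x - c, mem_univ _, c, hc, by ring⟩
    have h4 := h.excess
    have h5 := h.small
    have h6 := h.two_le
    rw [hMC, card_univ, ZMod.card] at h4
    have h7 : #M = p := by rw [huniv, card_univ, ZMod.card]
    omega
  have h3 := h.minimal _ hss h2
  have h4 := card_union_add_le M (M.image (· + t)) C
  have h5 := card_union_add_card_inter M (M.image (· + t))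
  have h6 : #(M.image (· + t) + C) = #(M + C) := by rw [image_add_add, card_image_add]
  have h7 := card_image_add M t
  have h8 := h.excess
  have h9 := h.small
  have h10 := h.two_le
  have h11 := card_le_card (subset_union_left (s₁ := M) (s₂ := M.image (· + t)))
  have h12 := h.le_excess (M ∪ M.image (· + t)) (by omega) (by omega)
  omega

/-- That is, `#(M + J) = #J * #M - (#J choose 2)`: each new translate of `M` overlaps the earlier
ones in as many points as there are earlier ones. -/
theorem IsExtremalSummand.card_add {θ : ℤ} (h : IsExtremalSummand C θ M) (hJ : J ⊆ M) (hJ1 : 1 ≤ #J) :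
    2 * #(M + J) + #J * #J = 2 * (#J * #M) + #J := by
  have hS := h.translatesMeetOnce
  induction J using Finset.induction_on with
  | empty => simp at hJ1
  | insert y J hy ih =>
    have hJM : J ⊆ M := (subset_insert y J).trans hJ
    have hyM : y ∈ M := hJ (mem_insert_self y J)
    rcases J.eq_empty_or_nonempty with rfl | hne
    · have h9 : #(M + {y}) = #M := by rw [image_add_right_eq]; exact card_image_add M y
      simp [h9]
    have ih := ih hJM hne.card_pos
    have h1 : M + insert y J = (M + J) ∪ M.image (· + y) := by
      rw [insert_eq, add_union, image_add_right_eq, union_comm]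
    have h2 := card_union_add_card_inter (M + J) (M.image (· + y))
    rw [hS.inter_eq hJM hyM hy, card_image_add, card_image_add] at h2
    rw [h1, card_insert_of_notMem hy]
    nlinarith

/-- Adding `M + y` contributes excess at most `θ`, while the overlap `J + y` has excess at least `θ
+ 1` by minimality, so each element after the second lowers the bound by one. The second element
behaves differently because a one-point overlap has excess `-1`. -/
theorem IsExtremalSummand.excess_add {θ : ℤ} (h : IsExtremalSummand C θ M) (hJ : J ⊆ M) (hJ2 : 2 ≤ #J) :
    (#(M + J + C) : ℤ) ≤ #(M + J) + #C + 2 * θ + 3 - #J := by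
  have hS := h.translatesMeetOnce
  induction J using Finset.induction_on with
  | empty => simp at hJ2
  | insert y J hy ih =>
    have hJM : J ⊆ M := (subset_insert y J).trans hJ
    have hyM : y ∈ M := hJ (mem_insert_self y J)
    have h1 : M + insert y J = (M + J) ∪ M.image (· + y) := by
      rw [insert_eq, add_union, image_add_right_eq, union_comm]
    have h2 := card_union_add_card_inter (M + J) (M.image (· + y))
    have h3 := card_union_add_le (M + J) (M.image (· + y)) C
    have h5 : #(M.image (· + y) + C) = #(M + C) := by rw [image_add_add, card_image_add]
    rw [hS.inter_eq hJM hyM hy] at h2 h3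
    rw [card_image_add, card_image_add] at h2
    rw [card_insert_of_notMem hy] at hJ2
    rw [h1, card_insert_of_notMem hy]
    have h8 := h.excess
    rcases Nat.lt_or_ge 1 (#J) with hJ1 | hJ1
    · have ih := ih hJM hJ1
      have hss : J ⊂ M := hJM.ssubset_of_ne fun e => hy (e ▸ hyM)
      have h6 := h.minimal' y hss hJ1
      push_cast
      omega
    · have hJ1' : #J = 1 := by omega
      obtain ⟨x, rfl⟩ := card_eq_one.1 hJ1'
      have h6 : #(M + {x} + C) = #(M + C) := by
        rw [image_add_right_eq, image_add_add, card_image_add]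
      have h7 : #(({x} : Finset (ZMod p)).image (· + y) + C) = #C := by
        rw [image_singleton, singleton_add]
        exact card_image_of_injective _ (add_right_injective _)
      have h9 : #(M + {x}) = #M := by rw [image_add_right_eq]; exact card_image_add M x
      rw [hJ1']
      push_cast
      omega

/-- The elements `z` with `-z` outside `X + C`. -/
def dualSummand {p : ℕ} [NeZero p] (C X : Finset (ZMod p)) : Finset (ZMod p) :=
  ((X + C)ᶜ).image (fun x => -x)

theorem sumAvoids_dualSummand (C X : Finset (ZMod p)) : SumAvoids 0 X C (dualSummand C X) := by
  intro x hx c hc z hz e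
  simp only [dualSummand, mem_image, mem_compl] at hz
  obtain ⟨y, hy, rfl⟩ := hz
  refine hy ?_
  have : y = x + c := by linear_combination -e
  rw [this]
  exact add_mem_add hx hc

theorem card_dualSummand (C X : Finset (ZMod p)) : #(dualSummand C X) + #(X + C) = p := by
  rw [dualSummand, card_image_of_injective _ neg_injective, card_compl, ZMod.card]
  have := card_le_univ (X + C)
  rw [ZMod.card] at this
  omega

/-- If `#M ≥ 3`, a three-element `J ⊆ M` makes the excess of `M + J` at most `-2`, which is possible
only if `M + J + C` misses at most one residue. Then the dual summand `Z` satisfies `#M ≤ #Z ≤ 2 #M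
- 3` and `#(M + Z) ≤ #M + #Z - 1`, too small for the second moment bound. -/
theorem IsExtremalSummand.card_le_two (h : IsExtremalSummand C (-1) M) : #M ≤ 2 := by
  by_contra! hm
  obtain ⟨J, hJ, hJ3⟩ := exists_subset_card_eq (show 3 ≤ #M by omega)
  have h1 := h.card_add hJ (by omega)
  have h2 := h.excess_add hJ (by omega)
  have h3 := h.le_excess (M + J)
  have h4 := (sumAvoids_dualSummand C M).rotate.rotate.swap.card_add_le
  have h5 := card_dualSummand C M
  have h6 := h.excess
  have h7 := h.small
  have h8 := h.le_excess M h.two_le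
  have h9 := h.translatesMeetOnce.card_add_bound (dualSummand C M) 1
  have h10 := h.translatesMeetOnce.card_add_bound (dualSummand C M) 2
  rw [hJ3] at h1 h2
  generalize dualSummand C M = Z at *
  set T := p - #C with hT
  have hN : #(M + Z) ≤ #Z + #M - 1 := by omega
  have hZ : #M ≤ #Z := by omega
  have hZ2 : #Z + 3 ≤ 2 * #M := by omega
  have hN' : #(M + Z) + 1 ≤ #Z + #M := by omega
  generalize #(M + Z) = N at *
  obtain ⟨k, hk⟩ := Nat.exists_eq_add_of_le hZ
  obtain ⟨m, hm'⟩ := Nat.exists_eq_add_of_le (show 3 ≤ #M by omega)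
  rw [hm'] at hk hN' hZ2 h9 h10
  rw [hk] at hN' hZ2 h9 h10
  rcases Nat.eq_zero_or_pos m with rfl | hm0
  · have : k = 0 := by omega
    subst this
    omega
  · have : k ≤ m := by omega
    have h11 := Nat.mul_le_mul_left k this
    have h12 := Nat.mul_pos hm0 hm0
    clear h1 h2 h3 h4 h5 h6 h7 h8 hk hm' hZ hZ2 this
    linarith

/-- The same contradiction with four elements in `J`: the excess of `M + J` is at most `-1`, and now
`#Z ≤ 3 #M - 6`. -/
theorem IsExtremalSummand.card_le_three (h : IsExtremalSummand C 0 M) : #M ≤ 3 := by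
  by_contra! hm
  obtain ⟨J, hJ, hJ3⟩ := exists_subset_card_eq (show 4 ≤ #M by omega)
  have h1 := h.card_add hJ (by omega)
  have h2 := h.excess_add hJ (by omega)
  have h3 := h.le_excess (M + J)
  have h4 := (sumAvoids_dualSummand C M).rotate.rotate.swap.card_add_le
  have h5 := card_dualSummand C M
  have h6 := h.excess
  have h7 := h.small
  have h8 := h.le_excess M h.two_le
  have h10 := h.translatesMeetOnce.card_add_bound (dualSummand C M) 2
  rw [hJ3] at h1 h2
  generalize dualSummand C M = Z at *
  have hZ : #M ≤ #Z := by omega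
  have hZ2 : #Z + 6 ≤ 3 * #M := by omega
  have hN' : #(M + Z) ≤ #Z + #M := by omega
  generalize #(M + Z) = N at *
  obtain ⟨k, hk⟩ := Nat.exists_eq_add_of_le hZ
  obtain ⟨m, hm'⟩ := Nat.exists_eq_add_of_le (show 4 ≤ #M by omega)
  rw [hm'] at hk hN' hZ2 h10
  rw [hk] at hN' hZ2 h10
  have : k ≤ 2 * m + 2 := by omega
  have h11 := Nat.mul_le_mul_left k this
  clear h1 h2 h3 h4 h5 h6 h7 h8 hk hm' hZ hZ2 this
  linarith [Nat.zero_le (m * m)]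

end

/-! ### Critical and nearly critical pairs: Vosper's theorem and its successor -/

section

variable {p : ℕ} [Fact p.Prime] {C X Y S : Finset (ZMod p)}

theorem pair_add_eq (x y : ZMod p) (C : Finset (ZMod p)) :
    ({x, y} : Finset (ZMod p)) + C = (outer C (y - x)).image (· + x) := by
  ext u
  simp only [mem_add, mem_insert, mem_singleton, outer, mem_image, mem_union]
  constructor
  · rintro ⟨v, rfl | rfl, c, hc, rfl⟩
    · exact ⟨c, Or.inl hc, add_comm _ _⟩
    · exact ⟨c + (v - x), Or.inr ⟨c, hc, rfl⟩, by ring⟩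
  · rintro ⟨v, hv | ⟨c, hc, rfl⟩, rfl⟩
    · exact ⟨x, Or.inl rfl, v, hv, add_comm _ _⟩
    · exact ⟨y, Or.inr rfl, c, hc, by ring⟩

theorem card_pair_add (x y : ZMod p) (C : Finset (ZMod p)) :
    #(({x, y} : Finset (ZMod p)) + C) = #C + runs C (y - x) := by
  rw [pair_add_eq, card_image_add, card_outer]

theorem exists_isExtremalSummand {θ : ℤ} (hC : C.Nonempty)
    (hθ : ∀ Y : Finset (ZMod p), 2 ≤ #Y → #(Y + C) + 2 ≤ p → (#Y + #C + θ : ℤ) ≤ #(Y + C))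
    (h2 : 2 ≤ #X) (hX : (#(X + C) : ℤ) ≤ #X + #C + θ) (hs : (2 * #X + #C + θ : ℤ) ≤ p) :
    ∃ M, IsExtremalSummand C θ M := by
  induction X using Finset.strongInduction with
  | H X ih =>
    by_cases h : ∃ W ⊂ X, 2 ≤ #W ∧ (#(W + C) : ℤ) ≤ #W + #C + θ
    · obtain ⟨W, hW, hW2, hWe⟩ := h
      have := card_lt_card hW
      exact ih W hW hW2 hWe (by omega)
    · push Not at h
      exact ⟨X, hC, hθ, h2, hX, fun W hW hW2 => by have := h W hW hW2; omega, hs⟩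

theorem le_card_add (hC : C.Nonempty) (hY : Y.Nonempty) (h : #(Y + C) < p) :
    #Y + #C ≤ #(Y + C) + 1 := by
  rcases min_le_iff.1 (ZMod.cauchy_davenport (Fact.out : p.Prime) hY hC) with h' | h' <;> omega

/-- Part of Vosper's theorem: a summand of a critical pair is an arithmetic progression. -/
theorem exists_runs_le_one (hC : C.Nonempty) (h2 : 2 ≤ #Y) (hp : #(Y + C) + 2 ≤ p)
    (hY : #(Y + C) + 1 ≤ #Y + #C) : ∃ d : ZMod p, d ≠ 0 ∧ runs C d ≤ 1 := by
  -- Criticality passes to the dual summand, and one of `Y` and its dual meets the size condition.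
  have key : ∃ X : Finset (ZMod p), 2 ≤ #X ∧ #(X + C) + 1 ≤ #X + #C ∧ 2 * #X + #C ≤ p + 1 := by
    have h3 := (sumAvoids_dualSummand C Y).rotate.rotate.swap.swap.card_add_le
    have h3' := (sumAvoids_dualSummand C Y).rotate.rotate.rotate.rotate.swap.card_add_le
    have h4 := card_dualSummand C Y
    have h5 := le_card_add hC (card_pos.1 (by omega)) (show #(Y + C) < p by omega)
    by_cases h : 2 * #Y + #C ≤ p + 1
    · exact ⟨Y, h2, hY, h⟩
    · exact ⟨dualSummand C Y, by omega, by omega, by omega⟩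
  obtain ⟨X, hX2, hX, hs⟩ := key
  obtain ⟨M, hM⟩ := exists_isExtremalSummand (C := C) (θ := -1) hC (fun Y hY hYp => by
    have := le_card_add hC (card_pos.1 (by omega)) (show #(Y + C) < p by omega)
    omega) hX2 (by omega) (by omega)
  obtain ⟨x, y, hxy, rfl⟩ := card_eq_two.1 (le_antisymm hM.card_le_two hM.two_le)
  refine ⟨y - x, sub_ne_zero.2 hxy.symm, ?_⟩
  have h1 := hM.excess
  rw [card_pair_add, card_pair hxy] at h1
  omega

theorem inner_union {Q H : Finset (ZMod p)} {e : ZMod p} (h1 : ∀ h ∈ H, h + e ∉ Q)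
    (h2 : ∀ q ∈ Q, q + e ∉ H) : inner' (Q ∪ H) e = inner' Q e ∪ inner' H e := by
  ext x
  simp only [inner', mem_filter, mem_union]
  have := h1 x
  have := h2 x
  tauto

theorem inner_image_add (S : Finset (ZMod p)) (t e : ZMod p) :
    inner' (S.image (· + t)) e = (inner' S e).image (· + t) := by
  ext x
  simp only [inner', mem_filter, mem_image]
  constructor
  · rintro ⟨⟨y, hy, rfl⟩, z, hz, h⟩
    have : z = y + e := by linear_combination h
    exact ⟨y, ⟨hy, this ▸ hz⟩, rfl⟩
  · rintro ⟨y, ⟨hy, hy'⟩, rfl⟩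
    exact ⟨⟨y, hy, rfl⟩, y + e, hy', by ring⟩

theorem card_inner_lt {e : ZMod p} (he : e ≠ 0) (hS : S.Nonempty) (hS' : S ≠ univ) :
    #(inner' S e) < #S := by
  have := one_le_runs he hS hS'
  have := card_inner_add_runs S e
  omega

/-- Let `Q` be the common intersection. With `e = x - y`, `Q` is the part of `E = D + x` whose
translate by `e` stays in `E`. The third translate is `Q` with three further points `H`, and `H` is
not adjacent to `Q` along `e`, so repeated erosion by `e` acts on `Q` and `H` separately. Since all
translates of `D` erode to equal sizes, each erosion of `E` loses exactly what is left of `H`: at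
most 3, 2, 1, then nothing. -/
theorem card_le_six_of_triangle {D : Finset (ZMod p)} {x y z : ZMod p} (hxy : x ≠ y)
    (hxz : D.image (· + x) ∩ D.image (· + z) = D.image (· + x) ∩ D.image (· + y))
    (hyz : D.image (· + y) ∩ D.image (· + z) = D.image (· + x) ∩ D.image (· + y))
    (hcard : #(D.image (· + x) ∩ D.image (· + y)) + 3 = #D) (hp : 5 ≤ p) (hD : D ≠ univ) :
    #D ≤ 6 := by
  set E := D.image (· + x) with hE
  set e := x - y with he
  have he0 : e ≠ 0 := sub_ne_zero.2 hxy
  have hcE : #E = #D := card_image_add D x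
  have hcz : #(D.image (· + z)) = #D := card_image_add D z
  have hmem : ∀ u, u ∈ D.image (· + y) ↔ u + e ∈ E := by
    intro u
    simp only [hE, mem_image]
    constructor
    · rintro ⟨v, hv, rfl⟩; exact ⟨v, hv, by rw [he]; ring⟩
    · rintro ⟨v, hv, h⟩; exact ⟨v, hv, by rw [he] at h; linear_combination h⟩
  have hQ : inner' E e = E ∩ D.image (· + y) := by
    ext u; simp only [inner', mem_filter, mem_inter, hmem]
  set Q := inner' E e with hQdef
  rw [← hQ] at hxz hyz hcard
  set H := D.image (· + z) \ Q with hH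
  have hQz : Q ⊆ D.image (· + z) := hxz ▸ inter_subset_right
  have hcH : #H = 3 := by rw [hH, card_sdiff_of_subset hQz]; omega
  have hHE : ∀ h ∈ H, h ∉ E := by
    intro h hh hE'
    rw [hH, mem_sdiff] at hh
    exact hh.2 (hxz ▸ mem_inter.2 ⟨hE', hh.1⟩)
  have hHE' : ∀ h ∈ H, h + e ∉ E := by
    intro h hh hE'
    rw [hH, mem_sdiff] at hh
    exact hh.2 (hyz ▸ mem_inter.2 ⟨(hmem h).2 hE', hh.1⟩)
  have huni : D.image (· + z) = Q ∪ H := by rw [hH, union_sdiff_of_subset hQz]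
  set f : Finset (ZMod p) → Finset (ZMod p) := fun S => inner' S e with hf
  have hfsub : ∀ k S, f^[k] S ⊆ S := by
    intro k
    induction k with
    | zero => intro S; simp
    | succ k ih => intro S; rw [Function.iterate_succ_apply']; exact inner_subset.trans (ih S)
  have hsplit : ∀ k, f^[k] (Q ∪ H) = f^[k] Q ∪ f^[k] H := by
    intro k
    induction k with
    | zero => rfl
    | succ k ih =>
      rw [Function.iterate_succ_apply', Function.iterate_succ_apply', Function.iterate_succ_apply',
        ih]
      refine inner_union (fun h hh hq => ?_) fun q hq hh => ?_
      · exact hHE' h (hfsub k _ hh) (inner_subset (hfsub k _ hq))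
      · have h1 := hfsub k _ hq
        rw [hQdef, inner', mem_filter] at h1
        exact hHE _ (hfsub k _ hh) h1.2
  have htrans : ∀ k t, #(f^[k] (D.image (· + t))) = #(f^[k] D) := by
    have : ∀ k t, f^[k] (D.image (· + t)) = (f^[k] D).image (· + t) := by
      intro k t
      induction k with
      | zero => rfl
      | succ k ih =>
        rw [Function.iterate_succ_apply', Function.iterate_succ_apply', ih]; exact inner_image_add _ _ _
    intro k t
    rw [this, card_image_add]
  have hrec : ∀ k, #(f^[k] E) = #(f^[k + 1] E) + #(f^[k] H) := by
    intro k
    have h1 : f^[k + 1] E = f^[k] Q := by rw [Function.iterate_succ_apply]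
    rw [h1, ← card_union_of_disjoint, ← hsplit, ← huni, htrans _ z, hE, htrans _ x]
    refine disjoint_left.2 fun u hu hu' => hHE u (hfsub k _ hu') (inner_subset (hfsub k _ hu))
  have hlt : ∀ S : Finset (ZMod p), #S ≤ 3 → #(f S) ≤ #S - 1 := by
    intro S hS
    rcases S.eq_empty_or_nonempty with rfl | hne
    · simp [hf, inner']
    · have := card_inner_lt he0 hne (fun h => by
        rw [h, card_univ, ZMod.card] at hS; omega)
      simp only [hf]; omega
  have e0 := hrec 0
  have e1 := hrec 1
  have e2 := hrec 2
  have e3 := hrec 3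
  have l1 := hlt H (by omega)
  have l2 := hlt (f H) (by omega)
  have l3 := hlt (f (f H)) (by omega)
  simp only [Function.iterate_succ, Function.iterate_zero, Function.comp, id] at e0 e1 e2 e3
  -- By now `H` is used up, so a further erosion would lose nothing; a nonempty proper subset always
  -- loses a point.
  have hE3 : f (f (f E)) = ∅ := by
    by_contra hne
    have := card_inner_lt he0 (nonempty_iff_ne_empty.2 hne) (fun h => by
      have h1 : f (f (f E)) ⊆ E := hfsub 3 E
      rw [h] at h1
      have h2 := card_le_card h1
      rw [card_univ, hcE] at h2
      exact hD ((card_eq_iff_eq_univ D).1 ((card_le_univ D).antisymm h2)))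
    change #(f (f (f (f E)))) < _ at this
    omega
  rw [hE3, card_empty] at e2
  omega

/-- As `C` is not a progression, Vosper makes `0` the least excess. A two-element extremal summand
gives the step. With three elements, minimality forces every pair to have the same sumset with `C`
as the whole triple, so the complement of `C` satisfies the triangle condition and has at most six
elements, against `h7`. -/
theorem exists_runs_le_two (hC : C.Nonempty) (hC2 : ∀ d : ZMod p, d ≠ 0 → 2 ≤ runs C d)
    (h2 : 2 ≤ #X) (hX : #(X + C) ≤ #X + #C) (hs : 2 * #X + #C ≤ p) (h7 : #C + 7 ≤ p) :
    ∃ d : ZMod p, d ≠ 0 ∧ runs C d ≤ 2 := by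
  obtain ⟨M, hM⟩ := exists_isExtremalSummand (C := C) (θ := 0) hC (fun Y hY hYp => by
    by_contra! h
    obtain ⟨d, hd, hd1⟩ := exists_runs_le_one hC hY hYp (by omega)
    have := hC2 d hd
    omega) h2 (by omega) (by omega)
  have hM3 := hM.card_le_three
  have hM2 := hM.two_le
  have hMe := hM.excess
  rcases (show #M = 2 ∨ #M = 3 by omega) with hc | hc
  · obtain ⟨x, y, hxy, rfl⟩ := card_eq_two.1 hc
    refine ⟨y - x, sub_ne_zero.2 hxy.symm, ?_⟩
    rw [card_pair_add, card_pair hxy] at hMe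
    omega
  · exfalso
    obtain ⟨x, y, z, hxy, hxz, hyz, rfl⟩ := card_eq_three.1 hc
    set F := ({x, y, z} : Finset (ZMod p)) + C with hF
    have himg : ∀ t, Cᶜ.image (· + t) = (C.image (· + t))ᶜ := fun t => by
      ext u
      simp only [mem_image, mem_compl, not_exists, not_and]
      exact ⟨fun ⟨v, hv, e⟩ w hw e' => hv (by rwa [add_right_cancel (e.trans e'.symm)]),
        fun h => ⟨u - t, fun hu => h _ hu (sub_add_cancel _ _), sub_add_cancel _ _⟩⟩
    have hpair : ∀ u v : ZMod p, u ≠ v → ({u, v} : Finset (ZMod p)) ⊂ {x, y, z} →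
        C.image (· + u) ∪ C.image (· + v) = F ∧ #F = #C + 3 := by
      intro u v huv hss
      have h1 := hM.minimal _ hss (by rw [card_pair huv])
      have h3 : C.image (· + u) ∪ C.image (· + v) = {u, v} + C := by
        rw [insert_eq, union_add]
        congr 1 <;> rw [add_comm, image_add_right_eq]
      rw [h3]
      have hsub : ({u, v} : Finset (ZMod p)) + C ⊆ F := add_subset_add_right hss.subset
      have h4 := card_le_card hsub
      rw [card_pair huv] at h1
      refine ⟨eq_of_subset_of_card_le hsub (by omega), by omega⟩
    have hs3 : ∀ u v : ZMod p, u ∈ ({x, y, z} : Finset (ZMod p)) →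
        v ∈ ({x, y, z} : Finset (ZMod p)) → u ≠ v →
        ({u, v} : Finset (ZMod p)) ⊂ {x, y, z} := by
      intro u v hu hv huv
      refine ssubset_of_subset_of_ne (by
        intro w hw; rw [mem_insert, mem_singleton] at hw; rcases hw with rfl | rfl <;> assumption)
        fun h => ?_
      rw [← h, card_pair huv] at hc
      omega
    obtain ⟨e1, hFc⟩ := hpair x y hxy (hs3 x y (by simp) (by simp) hxy)
    obtain ⟨e2, -⟩ := hpair x z hxz (hs3 x z (by simp) (by simp) hxz)
    obtain ⟨e3, -⟩ := hpair y z hyz (hs3 y z (by simp) (by simp) hyz)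
    have hint : ∀ u v, Cᶜ.image (· + u) ∩ Cᶜ.image (· + v)
        = (C.image (· + u) ∪ C.image (· + v))ᶜ := by
      intro u v; rw [himg, himg, compl_union]
    have hp := card_le_univ F
    rw [ZMod.card] at hp
    have hcc : #Cᶜ = p - #C := by rw [card_compl, ZMod.card]
    have := card_le_six_of_triangle (D := Cᶜ) (z := z) hxy (by rw [hint, hint, e1, e2])
      (by rw [hint, hint, e1, e3]) (by rw [hint, e1, card_compl, ZMod.card]; omega) (by omega)
      (fun h => by
        rw [compl_eq_univ_iff] at h
        exact hC.ne_empty h)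
    omega

end

/-! ### Sets with at most two runs -/

section

variable {p : ℕ} [Fact p.Prime] {b s : ZMod p} {C X Y S : Finset (ZMod p)}

/-- The exchange alone gives at most three runs for `X`. In case of equality the exchanged sets are
critical, so by Vosper the eroded set `W` is a progression of some step `v`. If `W` has at most one
run along `s`, two more exchanges bound the runs of `Y` and then of `X`. Otherwise `C = W ∪ (W +
s)`, the two parts meet because `#C ≥ 5`, and submodularity along `v` makes `C` a progression. -/
theorem runs_le_two_of_sumAvoids (h : SumAvoids b X Y C) (hcard : #X + #Y + #C = p)
    (hX : 2 ≤ #X) (hY : 2 ≤ #Y) (hC : 5 ≤ #C) (hs : s ≠ 0) (hCs : runs C s ≤ 2) :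
    (∃ d : ZMod p, d ≠ 0 ∧ runs C d ≤ 1) ∨ runs X s ≤ 2 := by
  by_contra! hcon
  obtain ⟨hC1, hX3⟩ := hcon
  have hXne : X.Nonempty := card_pos.1 (by omega)
  have hYne : Y.Nonempty := card_pos.1 (by omega)
  have h1 := h.runs_le hXne hYne s (by omega)
  have hC2 := hC1 s hs
  have hout := card_outer X s
  have hin := card_inner_add_runs C s
  have h2 : SumAvoids b (outer X s) Y (inner' C s) := h.outer_inner s
  set Z := outer X s with hZ
  set W := inner' C s with hW
  have hWne : W.Nonempty := card_pos.1 (by omega)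
  have h3 := h2.swap.rotate.card_add_le
  obtain ⟨v, hv, hv1⟩ := exists_runs_le_one (C := W) (Y := Z) hWne (by omega)
    (by omega) (by omega)
  rcases Nat.lt_or_ge (runs W s) 2 with hWs | hWs
  · have h4 := h2.swap.runs_le hYne (hXne.outer) s (by omega)
    have h5 := h.rotate.rotate.swap.runs_le hXne (card_pos.1 (by omega)) s (Z := Y) (by omega)
    omega
  · have hsub : outer W s ⊆ C := by
      intro x
      simp only [outer, mem_union, mem_image]
      rintro (hx | ⟨y, hy, rfl⟩)
      · exact inner_subset hx
      · exact (mem_filter.1 hy).2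
    have hc := card_outer W s
    have heq : outer W s = C := eq_of_subset_of_card_le hsub (by omega)
    have h4 := runs_union_add_runs_inter W (W.image (· + s)) v
    have h5 := card_union_add_card_inter W (W.image (· + s))
    have h6 : W ∪ W.image (· + s) = C := heq
    rw [h6, runs_image_add] at h4
    rw [h6, card_image_add] at h5
    have h7 : 1 ≤ runs (W ∩ W.image (· + s)) v := by
      refine one_le_runs hv (card_pos.1 (by omega)) fun h => ?_
      have h8 : (univ : Finset (ZMod p)) ⊆ W := h ▸ inter_subset_left
      have h9 := card_le_card h8
      rw [card_univ, ZMod.card] at h9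
      omega
    have := hC1 v hv
    omega

/-- A normal form for interval arithmetic: coordinates start at the first point of an arc. The
second arc is the shorter one, with `L = 0` when there is only one. -/
theorem exists_arcs (hS : S.Nonempty) (hS' : S ≠ univ) (h : runs S 1 ≤ 2) :
    ∃ (a : ZMod p) (K α L : ℕ), 1 ≤ K ∧ L ≤ K ∧ K ≤ α ∧ α + L < p ∧ (L = 0 ∨ K < α) ∧
      ∀ n < p, (a + (n : ZMod p) ∈ S ↔ n < K ∨ (α ≤ n ∧ n < α + L)) := by
  have hp := (Fact.out : p.Prime).two_le
  rw [← runs_compl] at h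
  have hne := one_le_runs (d := (1 : ZMod p)) one_ne_zero (S := Sᶜ)
    (by rw [nonempty_iff_ne_empty, ne_eq, compl_eq_empty_iff]; exact hS')
    (by rw [ne_eq, compl_eq_univ_iff]; exact hS.ne_empty)
  unfold runs at h hne
  obtain ⟨x, hx⟩ := card_pos.1 hne
  have hmem : ∀ y, y ∈ ({x ∈ Sᶜ | x + 1 ∉ Sᶜ} : Finset (ZMod p)) ↔ y ∉ S ∧ y + 1 ∈ S := by
    intro y; simp
  set F := ({x ∈ Sᶜ | x + 1 ∉ Sᶜ} : Finset (ZMod p))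
  have hx' := (hmem x).1 hx
  set a := x + 1 with ha
  have hcast : ∀ m n : ℕ, m < p → n < p → (m : ZMod p) = n → m = n := by
    intro m n hm hn e
    have := congrArg ZMod.val e
    rwa [ZMod.val_cast_of_lt hm, ZMod.val_cast_of_lt hn] at this
  have hlast : a + ((p - 1 : ℕ) : ZMod p) ∉ S := by
    rw [Nat.cast_sub (by omega), ZMod.natCast_self, ha]
    convert hx'.1 using 1
    push_cast; ring_nf
  have hstart : ∀ n, 0 < n → a + ((n - 1 : ℕ) : ZMod p) ∉ S → a + (n : ZMod p) ∈ S →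
      x + (n : ZMod p) ∈ F := by
    intro n hn h1 h2
    rw [hmem]
    obtain ⟨k, rfl⟩ : ∃ k, n = k + 1 := ⟨n - 1, by omega⟩
    refine ⟨?_, ?_⟩
    · rw [Nat.add_sub_cancel] at h1
      convert h1 using 1; rw [ha]; push_cast; ring_nf
    · convert h2 using 1; rw [ha]; ring
  have exK : ∃ n : ℕ, a + (n : ZMod p) ∉ S := ⟨p - 1, hlast⟩
  classical
  obtain ⟨K, hKspec, hKmin⟩ : ∃ K : ℕ, a + (K : ZMod p) ∉ S ∧
      ∀ n < K, a + (n : ZMod p) ∈ S :=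
    ⟨Nat.find exK, Nat.find_spec exK, fun n hn => not_not.1 (Nat.find_min exK hn)⟩
  have hKp : K < p := by
    by_contra! hh
    exact hlast (hKmin _ (by omega))
  have hK1 : 1 ≤ K := by
    by_contra! hh
    have : K = 0 := by omega
    subst this
    exact hKspec (by simpa using hx'.2)
  by_cases exα : ∃ n : ℕ, K ≤ n ∧ n < p ∧ a + (n : ZMod p) ∈ S
  swap
  · push Not at exα
    refine ⟨a, K, K, 0, hK1, by omega, le_rfl, by omega, Or.inl rfl, fun n hn => ?_⟩
    by_cases hnK : n < K
    · simp [hnK, hKmin n hnK]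
    · have := exα n (by omega) hn
      simp only [this, false_iff]; omega
  obtain ⟨α, ⟨hα1, hα2, hα3⟩, hαmin⟩ : ∃ α : ℕ, (K ≤ α ∧ α < p ∧ a + (α : ZMod p) ∈ S) ∧
      ∀ n < α, K ≤ n → a + (n : ZMod p) ∉ S :=
    ⟨Nat.find exα, Nat.find_spec exα, fun n hn hK hh =>
      Nat.find_min exα hn ⟨hK, hn.trans (Nat.find_spec exα).2.1, hh⟩⟩
  have hαK : K < α := lt_of_le_of_ne hα1 fun e => hKspec (e ▸ hα3)
  have exβ : ∃ n : ℕ, α ≤ n ∧ a + (n : ZMod p) ∉ S := ⟨p - 1, by omega, hlast⟩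
  obtain ⟨β, ⟨hβ1, hβ2⟩, hβmin⟩ : ∃ β : ℕ, (α ≤ β ∧ a + (β : ZMod p) ∉ S) ∧
      ∀ n < β, α ≤ n → a + (n : ZMod p) ∈ S :=
    ⟨Nat.find exβ, Nat.find_spec exβ, fun n hn hK => by
      by_contra hh; exact Nat.find_min exβ hn ⟨hK, hh⟩⟩
  have hβp : β < p := by
    by_contra! hh
    exact hlast (hβmin _ (by omega) (by omega))
  have hβα : α < β := lt_of_le_of_ne hβ1 fun e => hβ2 (e ▸ hα3)
  have hend : ∀ n, β ≤ n → n < p → a + (n : ZMod p) ∉ S := by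
    by_contra! exγ
    obtain ⟨γ, ⟨hγ1, hγ2, hγ3⟩, hγmin⟩ : ∃ γ : ℕ, (β ≤ γ ∧ γ < p ∧ a + (γ : ZMod p) ∈ S) ∧
        ∀ n < γ, β ≤ n → a + (n : ZMod p) ∉ S :=
      ⟨Nat.find exγ, Nat.find_spec exγ, fun n hn hK hh =>
        Nat.find_min exγ hn ⟨hK, hn.trans (Nat.find_spec exγ).2.1, hh⟩⟩
    have hγβ : β < γ := lt_of_le_of_ne hγ1 fun e => hβ2 (e ▸ hγ3)
    have h1 := hstart α (by omega) (hαmin _ (by omega) (by omega)) hα3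
    have h2 := hstart γ (by omega) (hγmin _ (by omega) (by omega)) hγ3
    have h3 : ({x, x + (α : ZMod p), x + (γ : ZMod p)} : Finset (ZMod p)) ⊆ F := by
      intro y hy
      simp only [mem_insert, mem_singleton] at hy
      rcases hy with rfl | rfl | rfl <;> assumption
    have h4 := card_le_card h3
    rw [card_eq_three.2 ⟨x, x + (α : ZMod p), x + (γ : ZMod p), ?_, ?_, ?_, rfl⟩] at h4
    · omega
    · intro e
      have : ((0 : ℕ) : ZMod p) = α := by push_cast; linear_combination e
      have := hcast _ _ (by omega) hα2 this
      omega
    · intro e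
      have : ((0 : ℕ) : ZMod p) = γ := by push_cast; linear_combination e
      have := hcast _ _ (by omega) hγ2 this
      omega
    · intro e
      have := hcast _ _ hα2 hγ2 (add_left_cancel e)
      omega
  have hfull : ∀ n < p, (a + (n : ZMod p) ∈ S ↔ n < K ∨ (α ≤ n ∧ n < β)) := by
    intro n hn
    by_cases h1 : n < K
    · simp [h1, hKmin n h1]
    by_cases h2 : n < α
    · have := hαmin n h2 (by omega)
      simp only [this, false_iff]; omega
    by_cases h3 : n < β
    · have := hβmin n h3 (by omega)
      simp only [this, true_iff]; omega
    · have := hend n (by omega) hn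
      simp only [this, false_iff]; omega
  -- If the second arc is the longer one, coordinates restart at `a + α`.
  by_cases hLK : β - α ≤ K
  · refine ⟨a, K, α, β - α, hK1, hLK, hα1, by omega, Or.inr hαK, fun n hn => ?_⟩
    rw [hfull n hn]
    omega
  · refine ⟨a + α, β - α, p - α, K, by omega, by omega, by omega, by omega, Or.inr (by omega),
      fun n hn => ?_⟩
    by_cases hw : α + n < p
    · have := hfull (α + n) hw
      rw [show a + α + (n : ZMod p) = a + ((α + n : ℕ) : ZMod p) by push_cast; ring, this]
      omega
    · have := hfull (α + n - p) (by omega)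
      rw [show a + α + (n : ZMod p) = a + ((α + n - p : ℕ) : ZMod p) by
        rw [Nat.cast_sub (by omega), ZMod.natCast_self]; push_cast; ring, this]
      omega

theorem card_add_card_add_card_le_runs (a : ZMod p) (τ : ZMod p) {u₁ v₁ u₂ v₂ u₃ v₃ : ℕ}
    (h12 : v₁ ≤ u₂) (h23 : v₂ ≤ u₃) (h2 : u₂ ≤ v₂) (hp : v₃ ≤ p) (hp2 : u₃ ≤ p)
    (h : ∀ n < p, (u₁ ≤ n ∧ n < v₁) ∨ (u₂ ≤ n ∧ n < v₂) ∨ (u₃ ≤ n ∧ n < v₃) →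
      a + (n : ZMod p) ∈ S ∧ a + (n : ZMod p) + τ ∉ S) :
    (v₁ - u₁) + (v₂ - u₂) + (v₃ - u₃) ≤ runs S τ := by
  have h1 : (Ico u₁ v₁ ∪ Ico u₂ v₂ ∪ Ico u₃ v₃).image (fun n : ℕ => a + (n : ZMod p))
      ⊆ {x ∈ S | x + τ ∉ S} := by
    intro x hx
    simp only [mem_image, mem_union, mem_Ico] at hx
    obtain ⟨n, hn, rfl⟩ := hx
    rw [mem_filter]
    exact h n (by omega) (by omega)
  have h3 := card_le_card h1
  rw [card_image_of_injOn, card_union_of_disjoint, card_union_of_disjoint, Nat.card_Ico,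
    Nat.card_Ico, Nat.card_Ico] at h3
  · exact h3
  · rw [disjoint_left]; intro n; simp only [mem_Ico]; omega
  · rw [disjoint_left]; intro n; simp only [mem_union, mem_Ico]; omega
  · intro m hm n hn e
    simp only [coe_union, coe_Ico, Set.mem_union, Set.mem_Ico] at hm hn
    have := congrArg ZMod.val (add_left_cancel e)
    rwa [ZMod.val_cast_of_lt (by omega), ZMod.val_cast_of_lt (by omega)] at this

/-- The longer arc has more than `κ` points. If `κ < τ ≤ K`, every gap of `S` has at most `κ`
points, since a shift by `τ` would otherwise carry too many points into it; this contradicts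
`hcard'`. If `τ > K`, no arc meets its own shift without wrapping around, and counting exits leaves
only `τ` near `p / 2`. -/
theorem step_le_of_runs_le {κ τ : ℕ} (hS1 : runs S 1 ≤ 2) (hτ : 1 ≤ τ) (hτp : 2 * τ < p)
    (hSτ : runs S (τ : ZMod p) ≤ κ) (hcard : 2 * κ + 1 ≤ #S) 
    (hcard' : #S + 2 * κ + 1 ≤ p ∨ ∃ x : ZMod p, ∀ n ≤ κ, x + (n : ZMod p) ∉ S) :
    τ ≤ κ ∨ p ≤ 2 * τ + κ := by
  have hSne : S.Nonempty := card_pos.1 (by omega)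
  have hSne' : S ≠ univ := by
    rintro rfl
    rcases hcard' with h | ⟨x, hx⟩
    · rw [card_univ, ZMod.card] at h; omega
    · exact hx 0 (by omega) (mem_univ _)
  obtain ⟨a, K, α, L, hK1, hLK, hKα, hαp, hor, hmem⟩ := exists_arcs hSne hSne' hS1
  have hScard : #S ≤ K + L := by
    have : S ⊆ (range K ∪ Ico α (α + L)).image (fun n : ℕ => a + (n : ZMod p)) := by
      intro x hx
      have e : a + (((x - a).val : ℕ) : ZMod p) = x := by rw [ZMod.natCast_zmod_val]; ring
      refine mem_image.2 ⟨(x - a).val, ?_, e⟩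
      have := (hmem (x - a).val (ZMod.val_lt _)).1 (by rw [e]; exact hx)
      simpa using this
    have h1 := (card_le_card this).trans card_image_le
    have h2 := card_union_le (range K) (Ico α (α + L))
    rw [card_range, Nat.card_Ico] at h2
    omega
  have hScard' : K + L ≤ #S := by
    have : (range K ∪ Ico α (α + L)).image (fun n : ℕ => a + (n : ZMod p)) ⊆ S := by
      intro x hx
      simp only [mem_image, mem_union, mem_range, mem_Ico] at hx
      obtain ⟨n, hn, rfl⟩ := hx
      exact (hmem n (by omega)).2 hn
    have h1 := card_le_card this
    rw [card_image_of_injOn, card_union_of_disjoint, card_range, Nat.card_Ico] at h1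
    · omega
    · rw [disjoint_left]; intro n; simp only [mem_range, mem_Ico]; omega
    · intro m hm n hn e
      simp only [coe_union, coe_Ico, Set.mem_union, Set.mem_Ico, coe_range, Set.mem_Iio] at hm hn
      have := congrArg ZMod.val (add_left_cancel e)
      rwa [ZMod.val_cast_of_lt (by omega), ZMod.val_cast_of_lt (by omega)] at this
  have hadd : ∀ n < p, (a + (n : ZMod p) + (τ : ZMod p) ∈ S ↔
      (n + τ < p ∧ (n + τ < K ∨ (α ≤ n + τ ∧ n + τ < α + L))) ∨
      (p ≤ n + τ ∧ (n + τ < p + K ∨ (p + α ≤ n + τ ∧ n + τ < p + α + L)))) := by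
    intro n hn
    by_cases hw : n + τ < p
    · rw [show a + (n : ZMod p) + (τ : ZMod p) = a + ((n + τ : ℕ) : ZMod p) by push_cast; ring,
        hmem _ hw]
      omega
    · rw [show a + (n : ZMod p) + (τ : ZMod p) = a + ((n + τ - p : ℕ) : ZMod p) by
        rw [Nat.cast_sub (by omega), ZMod.natCast_self]; push_cast; ring, hmem _ (by omega)]
      omega
  have hsub : ∀ n < p, (a + (n : ZMod p) + -(τ : ZMod p) ∈ S ↔
      (τ ≤ n ∧ (n < K + τ ∨ (α + τ ≤ n ∧ n < α + τ + L))) ∨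
      (n < τ ∧ (p + n < K + τ ∨ (α + τ ≤ p + n ∧ p + n < α + τ + L)))) := by
    intro n hn
    by_cases hw : τ ≤ n
    · rw [show a + (n : ZMod p) + -(τ : ZMod p) = a + ((n - τ : ℕ) : ZMod p) by
        rw [Nat.cast_sub hw]; ring, hmem _ (by omega)]
      omega
    · rw [show a + (n : ZMod p) + -(τ : ZMod p) = a + ((p + n - τ : ℕ) : ZMod p) by
        rw [Nat.cast_sub (by omega)]; push_cast; rw [ZMod.natCast_self]; ring, hmem _ (by omega)]
      omega
  by_contra! hcon
  obtain ⟨hκ, hκ'⟩ := hcon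
  by_cases hτK : τ ≤ K
  · obtain ⟨g, hg⟩ : ∃ g, g = min τ (if L = 0 then p - K else α - K) := ⟨_, rfl⟩
    have hg1 : g ≤ κ := by
      have := card_add_card_add_card_le_runs (S := S) a (τ : ZMod p) (u₁ := K - τ)
        (v₁ := K - τ + g) (u₂ := p) (v₂ := p) (u₃ := p) (v₃ := p) (by split_ifs at hg <;> omega)
        le_rfl le_rfl le_rfl le_rfl (fun n hn hh => by
          rw [hmem n hn, hadd n hn]; split_ifs at hg <;> omega)
      omega
    obtain ⟨g', hg'⟩ : ∃ g, g = min τ (p - (α + L)) := ⟨_, rfl⟩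
    have hg1' : g' ≤ κ := by
      have := card_add_card_add_card_le_runs (S := S) a (-(τ : ZMod p)) (u₁ := τ - g')
        (v₁ := τ) (u₂ := p) (v₂ := p) (u₃ := p) (v₃ := p) (by omega)
        le_rfl le_rfl le_rfl le_rfl (fun n hn hh => by
          rw [hmem n hn, hsub n hn]; omega)
      rw [runs_neg] at this
      omega
    rcases hcard' with hcard' | ⟨x, hx⟩
    · split_ifs at hg <;> omega
    · have hm := ZMod.val_lt (x - a)
      have hxm : ∀ n ≤ κ, x + (n : ZMod p) = a + (((x - a).val + n : ℕ) : ZMod p) := by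
        intro n _
        push_cast
        rw [ZMod.natCast_zmod_val]
        ring
      generalize (x - a).val = m at hm hxm
      have h0 := hx 0 (by omega)
      rw [hxm 0 (by omega), hmem _ (by omega)] at h0
      -- The `κ + 1` consecutive missing points cannot cross either arc, so they lie in a single
      -- gap.
      have hwrap : ∀ n ≤ κ, m + n ≠ p := by
        intro n hn e
        refine hx n hn ?_
        rw [hxm n hn, show ((m + n : ℕ) : ZMod p) = ((0 : ℕ) : ZMod p) by
          rw [e, ZMod.natCast_self, Nat.cast_zero], hmem 0 (by omega)]
        omega
      have hα : L ≠ 0 → ∀ n ≤ κ, m + n ≠ α := by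
        intro hL n hn e
        refine hx n hn ?_
        rw [hxm n hn, hmem _ (by omega)]
        omega
      have h1 := hwrap (p - m)
      have h2 := fun hL => hα hL (α - m)
      split_ifs at hg <;> omega
  · by_cases hL : L = 0
    · have := card_add_card_add_card_le_runs (S := S) a (τ : ZMod p) (u₁ := 0)
        (v₁ := K) (u₂ := p) (v₂ := p) (u₃ := p) (v₃ := p) (by omega)
        le_rfl le_rfl le_rfl le_rfl (fun n hn hh => by
          rw [hmem n hn, hadd n hn]; omega)
      omega
    -- Points of the first arc that fall short of the second or pass beyond it, and points of the
    -- second arc that do not wrap around to the first.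
    · obtain ⟨v₁, hv₁⟩ : ∃ v, v = min K (α - τ) := ⟨_, rfl⟩
      obtain ⟨u₂, hu₂⟩ : ∃ u, u = min K (α + L - τ) := ⟨_, rfl⟩
      obtain ⟨v₃, hv₃⟩ : ∃ u, u = max α (min (α + L) (p - τ)) := ⟨_, rfl⟩
      have := card_add_card_add_card_le_runs (S := S) a (τ : ZMod p) (u₁ := 0)
        (v₁ := v₁) (u₂ := u₂) (v₂ := K) (u₃ := α) (v₃ := v₃) (by omega) (by omega) (by omega)
        (by omega) (by omega) (fun n hn hh => by
          rw [hmem n hn, hadd n hn]; omega)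
      omega

/-- If a set that is neither too small nor too large has at most two runs along `1` and at most
`κ` along `t`, then `t` or `2 t` is a small integer. -/
theorem small_of_runs_le {κ : ℕ} {t : ZMod p} (hκ : 1 ≤ κ) (ht : t ≠ 0) (hS1 : runs S 1 ≤ 2)
    (hSt : runs S t ≤ κ) (hcard : 2 * κ + 1 ≤ #S)
    (hcard' : #S + 2 * κ + 1 ≤ p ∨ ∃ x : ZMod p, ∀ n ≤ κ, x + (n : ZMod p) ∉ S) :
    ∃ j : ℕ, 1 ≤ j ∧ j ≤ κ ∧ (t = j ∨ t = -j ∨ 2 * t = j ∨ 2 * t = -j) := by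
  have hv := ZMod.val_lt t
  have hv0 : t.val ≠ 0 := by rwa [ne_eq, ZMod.val_eq_zero]
  have hcast : ((t.val : ℕ) : ZMod p) = t := ZMod.natCast_zmod_val t
  have hp3 : 3 ≤ p := by
    have := card_le_univ S
    rw [ZMod.card] at this
    omega
  have hodd : ∀ τ : ℕ, p ≠ 2 * τ := by
    intro τ e
    have := (Nat.prime_dvd_prime_iff_eq Nat.prime_two (Fact.out : p.Prime)).1 ⟨τ, e⟩
    omega
  by_cases h : 2 * t.val < p
  · rcases step_le_of_runs_le hS1 (by omega) h (by rwa [hcast]) hcard hcard' with h1 | h1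
    · exact ⟨t.val, by omega, h1, Or.inl hcast.symm⟩
    · refine ⟨p - 2 * t.val, by omega, by omega, Or.inr (Or.inr (Or.inr ?_))⟩
      rw [Nat.cast_sub h.le, ZMod.natCast_self]; push_cast; rw [hcast]; ring
  · have := hodd t.val
    have hcast' : ((p - t.val : ℕ) : ZMod p) = -t := by
      rw [Nat.cast_sub hv.le, ZMod.natCast_self, hcast]; ring
    rcases step_le_of_runs_le (τ := p - t.val) hS1 (by omega) (by omega)
      (by rwa [hcast', runs_neg]) hcard hcard' with h1 | h1
    · exact ⟨p - t.val, by omega, h1, Or.inr (Or.inl (by rw [hcast']; ring))⟩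
    · refine ⟨2 * t.val - p, by omega, by omega, Or.inr (Or.inr (Or.inl ?_))⟩
      rw [Nat.cast_sub (by omega), ZMod.natCast_self]; push_cast; rw [hcast]; ring

end

/-- The dilate of `S` by `a`. -/
def dil {p : ℕ} (a : ZMod p) (S : Finset (ZMod p)) : Finset (ZMod p) := S.image (a * ·)

theorem dil_nonempty {p : ℕ} {c : ZMod p} {S : Finset (ZMod p)} :
    (dil c S).Nonempty ↔ S.Nonempty := image_nonempty

/-- `A`, `B`, `C` partition `ZMod p` and no solution of `∑ aᵢ xᵢ = b` meets all three of them. -/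
structure IsRainbowFree {p : ℕ} [Fact p.Prime] (a : Fin 3 → ZMod p) (b : ZMod p)
    (A B C : Finset (ZMod p)) : Prop where
  ne_zero : ∀ i, a i ≠ 0
  avoids : ∀ i j k : Fin 3, i ≠ j → i ≠ k → j ≠ k →
    SumAvoids b (dil (a i) A) (dil (a j) B) (dil (a k) C)
  disjoint₁₂ : Disjoint A B
  disjoint₁₃ : Disjoint A C
  disjoint₂₃ : Disjoint B C
  cover : ∀ x, x ∈ A ∨ x ∈ B ∨ x ∈ C

/-- `t` or `2 t` is, up to sign, one of `1, …, κ`. -/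
def IsSmall {p : ℕ} (κ : ℕ) (t : ZMod p) : Prop :=
  ∃ j : ℕ, 1 ≤ j ∧ j ≤ κ ∧ (t = j ∨ t = -j ∨ 2 * t = j ∨ 2 * t = -j)

/-! ### Rainbow-free partitions and coefficients equal up to sign -/

section

variable {p : ℕ} [Fact p.Prime] {b s : ZMod p} {a : Fin 3 → ZMod p} {A B C S : Finset (ZMod p)}

theorem card_dil {c : ZMod p} (hc : c ≠ 0) (S : Finset (ZMod p)) : #(dil c S) = #S :=
  card_image_of_injective _ (mul_right_injective₀ hc)

theorem runs_dil {c : ZMod p} (hc : c ≠ 0) (S : Finset (ZMod p)) (d : ZMod p) :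
    runs (dil c S) d = runs S (c⁻¹ * d) := by
  have := runs_image_mul S hc (c⁻¹ * d)
  rwa [mul_inv_cancel_left₀ hc] at this

theorem mem_dil {c : ZMod p} (hc : c ≠ 0) {S : Finset (ZMod p)} {x : ZMod p} :
    x ∈ dil c S ↔ c⁻¹ * x ∈ S := by
  simp only [dil, mem_image]
  constructor
  · rintro ⟨y, hy, rfl⟩; rwa [inv_mul_cancel_left₀ hc]
  · intro h; exact ⟨_, h, mul_inv_cancel_left₀ hc x⟩

namespace IsRainbowFree

theorem swap (h : IsRainbowFree a b A B C) : IsRainbowFree a b B A C where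
  ne_zero := h.ne_zero
  avoids i j k hij hik hjk := (h.avoids j i k hij.symm hjk hik).swap
  disjoint₁₂ := h.disjoint₁₂.symm
  disjoint₁₃ := h.disjoint₂₃
  disjoint₂₃ := h.disjoint₁₃
  cover x := by have := h.cover x; tauto

theorem rotate (h : IsRainbowFree a b A B C) : IsRainbowFree a b B C A where
  ne_zero := h.ne_zero
  avoids i j k hij hik hjk := (h.avoids k i j hik.symm hjk.symm hij).rotate
  disjoint₁₂ := h.disjoint₂₃
  disjoint₁₃ := h.disjoint₁₂.symm
  disjoint₂₃ := h.disjoint₁₃.symm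
  cover x := by have := h.cover x; tauto

theorem compl_eq (h : IsRainbowFree a b A B C) : Cᶜ = A ∪ B := by
  ext x
  have h1 := h.cover x
  have h2 : x ∈ A → x ∉ C := fun hx => disjoint_left.1 h.disjoint₁₃ hx
  have h3 : x ∈ B → x ∉ C := fun hx => disjoint_left.1 h.disjoint₂₃ hx
  rw [mem_compl, mem_union]
  tauto

theorem card_eq (h : IsRainbowFree a b A B C) : #A + #B + #C = p := by
  have h1 := card_compl C
  rw [h.compl_eq, card_union_of_disjoint h.disjoint₁₂, ZMod.card] at h1
  have h2 := card_le_univ C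
  rw [ZMod.card] at h2
  omega

theorem avoids' (h : IsRainbowFree a b A B C) {i k : Fin 3} (hik : i ≠ k) :
    ∃ j, i ≠ j ∧ j ≠ k ∧ SumAvoids b (dil (a i) A) (dil (a j) B) (dil (a k) C) := by
  obtain ⟨j, hij, hjk⟩ : ∃ j : Fin 3, i ≠ j ∧ j ≠ k := by revert i k; decide
  exact ⟨j, hij, hjk, h.avoids i j k hij hik hjk⟩

/-- The exchange applied to the dilated classes, whose sizes add up to `p`; this leaves room for one
extra run. -/
theorem runs_le (h : IsRainbowFree a b A B C) (hA : A.Nonempty) (hB : B.Nonempty) {i k : Fin 3}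
    (hik : i ≠ k) {d : ZMod p} (hd : runs C d < #C) :
    runs A ((a i)⁻¹ * (a k * d)) ≤ runs C d + 1 := by
  obtain ⟨j, hij, hjk, h1⟩ := h.avoids' hik
  have h2 : runs (dil (a k) C) (a k * d) = runs C d := runs_image_mul C (h.ne_zero k) d
  have h3 := h1.runs_le (dil_nonempty.2 hA) (dil_nonempty.2 hB) (a k * d)
    (by rw [h2, card_dil (h.ne_zero k)]; exact hd)
  rw [h2, runs_dil (h.ne_zero i), card_dil (h.ne_zero i), card_dil (h.ne_zero j),
    card_dil (h.ne_zero k)] at h3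
  have := h.card_eq
  omega

/-- The case of coefficients equal up to sign. -/
theorem false_of_sq_eq (h : IsRainbowFree a b A B C) (hsq : ∀ i j, a i ^ 2 = a j ^ 2)
    (hne : ∃ i j, a i ≠ a j) (hs : s ≠ 0) (hA : 2 ≤ #A) (hB : 2 ≤ #B) (hC : 2 ≤ #C)
    (hAs : runs A s ≤ 2) (hBs : runs B s ≤ 2) (hCs : runs C s ≤ 2) : False := by
  have hpm : ∀ i j, a i = a j ∨ a i = - a j := fun i j => sq_eq_sq_iff_eq_or_eq_neg.1 (hsq i j)
  have hijk : ∃ i j k : Fin 3, i ≠ j ∧ i ≠ k ∧ j ≠ k ∧ a i = a j ∧ a i = - a k := by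
    have h01 := hpm 0 1
    have h02 := hpm 0 2
    rcases h01 with h01 | h01 <;> rcases h02 with h02 | h02
    · exfalso
      obtain ⟨i, j, hij⟩ := hne
      have : ∀ i, a i = a 0 := by
        intro i; fin_cases i
        · rfl
        · exact h01.symm
        · exact h02.symm
      exact hij ((this i).trans (this j).symm)
    · exact ⟨0, 1, 2, by decide, by decide, by decide, h01, h02⟩
    · exact ⟨0, 2, 1, by decide, by decide, by decide, h02, h01⟩
    · exact ⟨1, 2, 0, by decide, by decide, by decide,
        neg_injective (h01.symm.trans h02), by rw [h01, neg_neg]⟩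
  obtain ⟨i, j, k, hij, hik, hjk, eij, eik⟩ := hijk
  have hk0 := h.ne_zero i
  set c := (a i)⁻¹ * b with hc
  -- a solution-free form of the hypothesis: `x + y - z ≠ c`
  have core : ∀ X Y Z : Finset (ZMod p), IsRainbowFree a b X Y Z →
      ∀ x ∈ X, ∀ y ∈ Y, ∀ z ∈ Z, x + y - z ≠ c := by
    intro X Y Z hh x hx y hy z hz e
    refine hh.avoids i j k hij hik hjk _ (mem_image_of_mem _ hx) _ (mem_image_of_mem _ hy) _
      (mem_image_of_mem _ hz) ?_
    have e1 : a k = - a i := by rw [eik, neg_neg]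
    have : a i * c = b := mul_inv_cancel_left₀ hk0 b
    rw [← eij, e1, ← this, ← e]
    ring
  -- With `x = s + c` the equation `x + y - z = c` reads `z = y + s`. So `Y` and `Z` are never
  -- adjacent along `s`, and all their runs end in `X`.
  have main : ∀ X Y Z : Finset (ZMod p), IsRainbowFree a b X Y Z → 2 ≤ #X → 2 ≤ #Y → 2 ≤ #Z →
      runs X s ≤ 2 → s + c ∈ X → False := by
    intro X Y Z hh hX hY hZ hXs hsX
    have hcard := hh.card_eq
    have hne_univ : ∀ T : Finset (ZMod p), #T < p → T ≠ univ := by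
      rintro T hT rfl; rw [card_univ, ZMod.card] at hT; omega
    have adjYZ : ∀ y ∈ Y, y + s ∉ Z := fun y hy hz =>
      core X Y Z hh _ hsX y hy _ hz (by ring)
    have adjZY : ∀ z ∈ Z, z + s ∉ Y := fun z hz hy =>
      core X Z Y hh.swap.rotate _ hsX z hz _ hy (by ring)
    have dYZ := disjoint_left.1 hh.disjoint₂₃
    have hsum : runs Y s + runs Z s ≤ 2 := by
      refine le_trans ?_ hXs
      rw [← runs_neg X]
      unfold runs
      rw [← card_image_add {x ∈ Y | x + s ∉ Y} s, ← card_image_add {x ∈ Z | x + s ∉ Z} s,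
        ← card_union_of_disjoint]
      · refine card_le_card fun u hu => ?_
        simp only [mem_union, mem_image, mem_filter] at hu ⊢
        rcases hu with ⟨y, ⟨hy, hy'⟩, rfl⟩ | ⟨y, ⟨hy, hy'⟩, rfl⟩
        · refine ⟨(hh.cover (y + s)).resolve_right fun h' => h'.elim hy' (adjYZ y hy), ?_⟩
          rw [add_neg_cancel_right]
          exact fun h' => disjoint_left.1 hh.disjoint₁₂ h' hy
        · refine ⟨(hh.cover (y + s)).resolve_right fun h' => h'.elim (adjZY y hy) hy', ?_⟩
          rw [add_neg_cancel_right]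
          exact fun h' => disjoint_left.1 hh.disjoint₁₃ h' hy
      · rw [disjoint_left]
        intro u hu hu'
        simp only [mem_image, mem_filter] at hu hu'
        obtain ⟨y, hy, rfl⟩ := hu
        obtain ⟨z, hz, e⟩ := hu'
        exact dYZ hy.1 (add_right_cancel e ▸ hz.1)
    have hYne : Y.Nonempty := card_pos.1 (by omega)
    have hZne : Z.Nonempty := card_pos.1 (by omega)
    have hY1 := one_le_runs hs hYne (hne_univ Y (by omega))
    have hZ1 := one_le_runs hs hZne (hne_univ Z (by omega))
    -- `Y` and `Z` are progressions of step `s`, hence so is `V`. It avoids `X` and is larger than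
    -- either of `Y` and `Z`, so it would have to pass from one to the other without leaving `Y ∪
    -- Z`.
    set V := (Y + Z).image (· + -c) with hV
    have hVsub : V ⊆ Y ∪ Z := by
      intro v hv
      obtain ⟨w, hw, rfl⟩ := mem_image.1 hv
      obtain ⟨y, hy, z, hz, rfl⟩ := mem_add.1 hw
      rw [mem_union]
      refine (hh.cover _).resolve_left fun hX' => ?_
      exact core Y Z X hh.rotate y hy z hz _ hX' (by ring)
    have hVne : V.Nonempty := (hYne.add hZne).image _
    have hVcard : #V = #(Y + Z) := card_image_add _ _
    have hVle := card_le_card hVsub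
    rw [card_union_of_disjoint hh.disjoint₂₃] at hVle
    have hcd := le_card_add hZne hYne (show #(Y + Z) < p by omega)
    have hYe : ∀ y ∈ Y, ∀ y' ∈ Y, y + s ∉ Y → y' + s ∉ Y → y = y' := fun y hy y' hy' h1 h2 =>
      card_le_one.1 (show #{x ∈ Y | x + s ∉ Y} ≤ 1 by unfold runs at hsum hZ1; omega) _
        (mem_filter.2 ⟨hy, h1⟩) _ (mem_filter.2 ⟨hy', h2⟩)
    have hZe : ∀ y ∈ Z, ∀ y' ∈ Z, y + s ∉ Z → y' + s ∉ Z → y = y' := fun y hy y' hy' h1 h2 =>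
      card_le_one.1 (show #{x ∈ Z | x + s ∉ Z} ≤ 1 by unfold runs at hsum hY1; omega) _
        (mem_filter.2 ⟨hy, h1⟩) _ (mem_filter.2 ⟨hy', h2⟩)
    have hVe : ∀ v ∈ V, ∀ v' ∈ V, v + s ∉ V → v' + s ∉ V → v = v' := by
      intro v hv v' hv' h1 h2
      obtain ⟨w, hw, rfl⟩ := mem_image.1 hv
      obtain ⟨y, hy, z, hz, rfl⟩ := mem_add.1 hw
      obtain ⟨w', hw', rfl⟩ := mem_image.1 hv'
      obtain ⟨y', hy', z', hz', rfl⟩ := mem_add.1 hw'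
      have e1 : y = y' := by
        refine hYe y hy y' hy' (fun h' => h1 ?_) fun h' => h2 ?_
        · exact mem_image.2 ⟨_, add_mem_add h' hz, by ring⟩
        · exact mem_image.2 ⟨_, add_mem_add h' hz', by ring⟩
      have e2 : z = z' := by
        refine hZe z hz z' hz' (fun h' => h1 ?_) fun h' => h2 ?_
        · exact mem_image.2 ⟨_, add_mem_add hy h', by ring⟩
        · exact mem_image.2 ⟨_, add_mem_add hy' h', by ring⟩
      rw [e1, e2]
    have hend : ∀ P Q : Finset (ZMod p), #P < p → (∀ x ∈ P, x + s ∉ Q) → V ⊆ P ∪ Q →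
        (V ∩ P).Nonempty → ∃ v ∈ V, v ∈ P ∧ v + s ∉ V := by
      intro P Q hP hPQ hsub hne
      have h1 := one_le_runs hs hne (hne_univ _
        ((card_le_card (inter_subset_right (s₁ := V))).trans_lt hP))
      obtain ⟨v, hv⟩ := card_pos.1 h1
      simp only [mem_filter, mem_inter, not_and] at hv
      refine ⟨v, hv.1.1, hv.1.2, fun h' => ?_⟩
      rcases mem_union.1 (hsub h') with h2 | h2
      · exact hv.2 h' h2
      · exact hPQ v hv.1.2 h2
    by_cases hVY : (V ∩ Y).Nonempty
    · by_cases hVZ : (V ∩ Z).Nonempty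
      · obtain ⟨v, hv, hvY, hv'⟩ := hend Y Z (by omega) adjYZ hVsub hVY
        obtain ⟨w, hw, hwZ, hw'⟩ := hend Z Y (by omega) adjZY (union_comm Y Z ▸ hVsub) hVZ
        exact dYZ hvY (hVe v hv w hw hv' hw' ▸ hwZ)
      · have : V ⊆ Y := fun v hv => (mem_union.1 (hVsub hv)).resolve_right fun hz =>
          hVZ ⟨v, mem_inter.2 ⟨hv, hz⟩⟩
        have := card_le_card this
        omega
    · have : V ⊆ Z := fun v hv => (mem_union.1 (hVsub hv)).resolve_left fun hz =>
        hVY ⟨v, mem_inter.2 ⟨hv, hz⟩⟩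
      have := card_le_card this
      omega
  rcases h.cover (s + c) with hx | hx | hx
  · exact main A B C h hA hB hC hAs hx
  · exact main B C A h.rotate hB hC hA hBs hx
  · exact main C A B h.rotate.rotate hC hA hB hCs hx

end IsRainbowFree

theorem isSmall_div_of_runs_le {κ : ℕ} {t : ZMod p} (hκ : 1 ≤ κ) (hs : s ≠ 0) (ht : t ≠ 0)
    (hSs : runs S s ≤ 2) (hSt : runs S t ≤ κ) (hcard : 2 * κ + 1 ≤ #S)
    (hcard' : #S + 2 * κ + 1 ≤ p ∨ ∃ x : ZMod p, ∀ n ≤ κ, x + (n : ZMod p) * s ∉ S) :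
    IsSmall κ (t / s) := by
  have hs' : s⁻¹ ≠ 0 := inv_ne_zero hs
  refine small_of_runs_le (S := dil s⁻¹ S) hκ (div_ne_zero ht hs) ?_ ?_ ?_ ?_
  · rwa [runs_dil hs', inv_inv, mul_one]
  · rwa [runs_dil hs', inv_inv, mul_div_cancel₀ _ hs]
  · rwa [card_dil hs']
  · rw [card_dil hs']
    refine hcard'.imp id ?_
    rintro ⟨x, hx⟩
    refine ⟨s⁻¹ * x, fun n hn hmem => hx n hn ?_⟩
    rw [mem_dil hs', inv_inv] at hmem
    convert hmem using 1
    field_simp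

theorem isSmall_two {t : ZMod p} (h : IsSmall 2 t) :
    ∃ w ∈ ({1, -1, 2, -2, 4, -4} : Finset ℤ), 2 * t = w := by
  obtain ⟨j, h1, h2, h⟩ := h
  interval_cases j <;> rcases h with h | h | h | h
  · exact ⟨2, by decide, by rw [h]; norm_num⟩
  · exact ⟨-2, by decide, by rw [h]; norm_num⟩
  · exact ⟨1, by decide, by rw [h]; norm_num⟩
  · exact ⟨-1, by decide, by rw [h]; norm_num⟩
  · exact ⟨4, by decide, by rw [h]; norm_num⟩
  · exact ⟨-4, by decide, by rw [h]; norm_num⟩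
  · exact ⟨2, by decide, by rw [h]; norm_num⟩
  · exact ⟨-2, by decide, by rw [h]; norm_num⟩

theorem isSmall_three {t : ZMod p} (h : IsSmall 3 t) :
    ∃ w ∈ ({1, -1, 2, -2, 3, -3, 4, -4, 6, -6} : Finset ℤ), 2 * t = w := by
  obtain ⟨j, h1, h2, h⟩ := h
  interval_cases j <;> rcases h with h | h | h | h
  · exact ⟨2, by decide, by rw [h]; norm_num⟩
  · exact ⟨-2, by decide, by rw [h]; norm_num⟩
  · exact ⟨1, by decide, by rw [h]; norm_num⟩
  · exact ⟨-1, by decide, by rw [h]; norm_num⟩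
  · exact ⟨4, by decide, by rw [h]; norm_num⟩
  · exact ⟨-4, by decide, by rw [h]; norm_num⟩
  · exact ⟨2, by decide, by rw [h]; norm_num⟩
  · exact ⟨-2, by decide, by rw [h]; norm_num⟩
  · exact ⟨6, by decide, by rw [h]; norm_num⟩
  · exact ⟨-6, by decide, by rw [h]; norm_num⟩
  · exact ⟨3, by decide, by rw [h]; norm_num⟩
  · exact ⟨-3, by decide, by rw [h]; norm_num⟩

/-- Turns congruences between small integers into equalities. The bound 50 exceeds every difference
in the finite checks below; primes under 50 are left to `hnd`. -/
theorem int_eq_of_cast_eq {m n : ℤ} (h : (m : ZMod p) = n)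
    (hnd : ∀ q : ℕ, q < 50 → q.Prime → q = p → (q : ℤ) ∣ m - n → m = n) (hlt : |m - n| < 50) : m = n := by
  by_contra hmn
  have hd : (p : ℤ) ∣ m - n := (ZMod.intCast_eq_intCast_iff_dvd_sub n m p).1 h.symm
  have hle := Int.le_of_dvd (abs_pos.2 (sub_ne_zero.2 hmn)) ((dvd_abs _ _).2 hd)
  exact hmn (hnd p (by omega) Fact.out rfl hd)

theorem sq_eq_one_of_two_mul (hp : 11 ≤ p) {u : ZMod p} {w : ℤ} (e : 2 * u = w) (hw : w ^ 2 = 4) :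
    u ^ 2 = 1 := by
  have h22 : (4 : ZMod p) ≠ 0 := by
    intro h0
    have hd : p ∣ 4 := (ZMod.natCast_eq_zero_iff 4 p).1 (by exact_mod_cast h0)
    have := Nat.le_of_dvd (by norm_num) hd
    omega
  have h5 : (4 : ZMod p) * u ^ 2 = 4 * 1 := by
    have := congrArg (Int.cast : ℤ → ZMod p) hw
    push_cast at this
    rw [← e] at this
    linear_combination this
  exact mul_left_cancel₀ h22 h5

/-- Writing `2 u = w` and `2 u² = v` gives `w² ≡ 2 v` with finitely many candidates. The prime 7
must be excluded: it divides `4² - 2 * 1`. -/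
theorem sq_eq_one_of_isSmall_two (hp : 11 ≤ p) {u : ZMod p} (h1 : IsSmall 2 u)
    (h2 : IsSmall 2 (u ^ 2)) : u ^ 2 = 1 := by
  obtain ⟨w, hw, e⟩ := isSmall_two h1
  obtain ⟨v, hv, f⟩ := isSmall_two h2
  have h : ((w ^ 2 : ℤ) : ZMod p) = (2 * v : ℤ) := by
    push_cast; rw [← e, ← f]; ring
  have hfin : ∀ w ∈ ({1, -1, 2, -2, 4, -4} : Finset ℤ), ∀ v ∈ ({1, -1, 2, -2, 4, -4} : Finset ℤ),
      |w ^ 2 - 2 * v| < 50 ∧ (∀ q : ℕ, q < 50 → q.Prime → 11 ≤ q → (q : ℤ) ∣ w ^ 2 - 2 * v →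
        w ^ 2 = 2 * v) ∧ (w ^ 2 = 2 * v → w ^ 2 = 4) := by
    decide +kernel
  obtain ⟨h3, h4, h5⟩ := hfin w hw v hv
  exact sq_eq_one_of_two_mul hp e (h5 (int_eq_of_cast_eq h
    (fun q hq hq' hqp hd => h4 q hq hq' (hqp ▸ hp) hd) h3))

/-- Smallness of the inverse first removes `2 u = ±3, ±6`; here 13 must be excluded, as it divides
`3 * (-3) - 4`. -/
theorem sq_eq_one_of_isSmall_three (hp : 17 ≤ p) {u : ZMod p} (hu : u ≠ 0) (h1 : IsSmall 3 u)
    (h1' : IsSmall 3 u⁻¹) (h2 : IsSmall 3 (u ^ 2)) : u ^ 2 = 1 := by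
  obtain ⟨w, hw, e⟩ := isSmall_three h1
  obtain ⟨w', hw', e'⟩ := isSmall_three h1'
  obtain ⟨v, hv, f⟩ := isSmall_three h2
  have h : ((w ^ 2 : ℤ) : ZMod p) = (2 * v : ℤ) := by
    push_cast; rw [← e, ← f]; ring
  have h' : ((w * w' : ℤ) : ZMod p) = (4 : ℤ) := by
    push_cast; rw [← e, ← e']; field_simp; norm_num
  have hfin' : ∀ w ∈ ({1, -1, 2, -2, 3, -3, 4, -4, 6, -6} : Finset ℤ),
      ∀ v ∈ ({1, -1, 2, -2, 3, -3, 4, -4, 6, -6} : Finset ℤ),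
      |w * v - 4| < 50 ∧ (∀ q : ℕ, q < 50 → q.Prime → 17 ≤ q → (q : ℤ) ∣ w * v - 4 →
        w * v = 4) ∧ (w * v = 4 → w ∈ ({1, -1, 2, -2, 4, -4} : Finset ℤ)) := by
    decide +kernel
  have hfin : ∀ w ∈ ({1, -1, 2, -2, 4, -4} : Finset ℤ),
      ∀ v ∈ ({1, -1, 2, -2, 3, -3, 4, -4, 6, -6} : Finset ℤ),
      |w ^ 2 - 2 * v| < 50 ∧ (∀ q : ℕ, q < 50 → q.Prime → 17 ≤ q → (q : ℤ) ∣ w ^ 2 - 2 * v →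
        w ^ 2 = 2 * v) ∧ (w ^ 2 = 2 * v → w ^ 2 = 4) := by
    decide +kernel
  obtain ⟨k3, k4, k5⟩ := hfin' w hw w' hw'
  have hw := k5 (int_eq_of_cast_eq h' (fun q hq hq' hqp hd => k4 q hq hq' (hqp ▸ hp) hd) k3)
  obtain ⟨h3, h4, h5⟩ := hfin w hw v hv
  exact sq_eq_one_of_two_mul (by omega) e (h5 (int_eq_of_cast_eq h
    (fun q hq hq' hqp hd => h4 q hq hq' (hqp ▸ hp) hd) h3))

end

/-! ### From few runs to equal squares: the large cases -/

section

variable {p : ℕ} [Fact p.Prime] {b s : ZMod p} {a : Fin 3 → ZMod p} {A B C S : Finset (ZMod p)}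

theorem sq_eq_sq_of_div {x y : ZMod p} (hy : y ≠ 0) (h : (x / y) ^ 2 = 1) : x ^ 2 = y ^ 2 := by
  rw [div_pow, div_eq_one_iff_eq (pow_ne_zero 2 hy)] at h
  exact h

theorem runs_ratio_of_sq_eq {x y : ZMod p} (hx : x ≠ 0) (h : x ^ 2 = y ^ 2) (S : Finset (ZMod p))
    (s : ZMod p) : runs S (x⁻¹ * (y * s)) = runs S s := by
  rcases sq_eq_sq_iff_eq_or_eq_neg.1 h with rfl | e
  · rw [inv_mul_cancel_left₀ hx]
  · rw [show y = - x by rw [e, neg_neg], neg_mul, mul_neg, inv_mul_cancel_left₀ hx, runs_neg]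

/-- For `u = a i / a j`, two of the steps have quotient `u` (through the third index) and two have
quotient `u²`. -/
theorem sq_eq_of_runs_ratio_le_two (ha : ∀ i, a i ≠ 0) (hp : 11 ≤ p) (hs : s ≠ 0) (h5 : 5 ≤ #S)
    (h5' : #S + 5 ≤ p) (hr : ∀ i k, i ≠ k → runs S ((a i)⁻¹ * (a k * s)) ≤ 2) (i j : Fin 3) :
    a i ^ 2 = a j ^ 2 := by
  by_cases hij : i = j
  · rw [hij]
  obtain ⟨m, hmi, hmj⟩ : ∃ m : Fin 3, m ≠ i ∧ m ≠ j := by clear hij; revert i j; decide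
  have hi := ha i
  have hj := ha j
  have hm := ha m
  have hn : ∀ k l, (a k)⁻¹ * (a l * s) ≠ 0 := fun k l =>
    mul_ne_zero (inv_ne_zero (ha k)) (mul_ne_zero (ha l) hs)
  have h1 := isSmall_div_of_runs_le (by norm_num) (hn m j) (hn m i) (hr m j hmj) (hr m i hmi)
    h5 (Or.inl h5')
  have h2 := isSmall_div_of_runs_le (by norm_num) (hn i j) (hn j i) (hr i j hij)
    (hr j i (Ne.symm hij)) h5 (Or.inl h5')
  refine sq_eq_sq_of_div hj (sq_eq_one_of_isSmall_two hp ?_ ?_)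
  · convert h1 using 1; field_simp
  · convert h2 using 1; field_simp

theorem sq_eq_of_runs_ratio_le_three (ha : ∀ i, a i ≠ 0) (hp : 17 ≤ p) (hs : s ≠ 0) (h7 : 7 ≤ #S)
    (h7' : #S + 7 ≤ p) (hS : runs S s ≤ 2) (hr : ∀ i k i' k', i ≠ k → i' ≠ k' →
      runs S ((a i)⁻¹ * (a k * ((a i')⁻¹ * (a k' * s)))) ≤ 3) (i j : Fin 3) :
    a i ^ 2 = a j ^ 2 := by
  by_cases hij : i = j
  · rw [hij]
  obtain ⟨m, hmi, hmj⟩ : ∃ m : Fin 3, m ≠ i ∧ m ≠ j := by clear hij; revert i j; decide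
  have hi := ha i
  have hj := ha j
  have hm := ha m
  have key : ∀ i k i' k', i ≠ k → i' ≠ k' →
      IsSmall 3 ((a i)⁻¹ * (a k * ((a i')⁻¹ * (a k' * s))) / s) := fun i k i' k' h h' =>
    isSmall_div_of_runs_le (by norm_num) hs (mul_ne_zero (inv_ne_zero (ha _)) (mul_ne_zero (ha _)
      (mul_ne_zero (inv_ne_zero (ha _)) (mul_ne_zero (ha _) hs)))) hS (hr i k i' k' h h') h7
      (Or.inl h7')
  refine sq_eq_sq_of_div hj (sq_eq_one_of_isSmall_three hp (div_ne_zero hi hj) ?_ ?_ ?_)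
  · convert key m i j m hmi hmj.symm using 1; field_simp
  · convert key m j i m hmj hmi.symm using 1; field_simp
  · convert key j i j i (Ne.symm hij) (Ne.symm hij) using 1; field_simp

namespace IsRainbowFree

/-- A progression passes at most two runs to the other classes along every ratio of its step; this
forces equal squares, after which all three classes have few runs along `s` itself. -/
theorem false_of_arithmetic (h : IsRainbowFree a b A B C) (hne : ∃ i j, a i ≠ a j) (hp : 11 ≤ p)
    (hA : 2 ≤ #A) (hB : 2 ≤ #B) (hC : 5 ≤ #C) (hAB : 5 ≤ #A + #B) (hs : s ≠ 0)
    (hAs : runs A s ≤ 1) : False := by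
  have hcard := h.card_eq
  have hAne : A.Nonempty := card_pos.1 (by omega)
  have hBne : B.Nonempty := card_pos.1 (by omega)
  have hCne : C.Nonempty := card_pos.1 (by omega)
  have hrC : ∀ i k, i ≠ k → runs C ((a i)⁻¹ * (a k * s)) ≤ 2 := fun i k hik =>
    (h.swap.rotate.rotate.runs_le hCne hBne hik (by omega)).trans (by omega)
  have hrB : ∀ i k, i ≠ k → runs B ((a i)⁻¹ * (a k * s)) ≤ 2 := fun i k hik =>
    (h.rotate.runs_le hBne hCne hik (by omega)).trans (by omega)
  have hsq := sq_eq_of_runs_ratio_le_two h.ne_zero hp hs hC (by omega) hrC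
  have h01 : (0 : Fin 3) ≠ 1 := by decide
  refine h.false_of_sq_eq hsq hne hs hA hB (by omega) (by omega) ?_ ?_
  · rw [← runs_ratio_of_sq_eq (h.ne_zero 0) (hsq 0 1)]; exact hrB 0 1 h01
  · rw [← runs_ratio_of_sq_eq (h.ne_zero 0) (hsq 0 1)]; exact hrC 0 1 h01

/-- A common step along which all three classes have few runs. -/
theorem exists_step (h : IsRainbowFree a b A B C) (hA : 2 ≤ #A) (hAB : #A ≤ #B) (hC : 5 ≤ #C)
    (hAB7 : 7 ≤ #A + #B) : ∃ s : ZMod p, s ≠ 0 ∧ runs C s ≤ 2 ∧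
      (∀ i k, i ≠ k → runs A ((a i)⁻¹ * (a k * s)) ≤ 2) ∧
      (∀ i k, i ≠ k → runs B ((a i)⁻¹ * (a k * s)) ≤ 2) := by
  have hcard := h.card_eq
  have hAne : A.Nonempty := card_pos.1 (by omega)
  have hBne : B.Nonempty := card_pos.1 (by omega)
  have hCne : C.Nonempty := card_pos.1 (by omega)
  by_cases hap : ∃ d : ZMod p, d ≠ 0 ∧ runs C d ≤ 1
  · obtain ⟨d, hd, hd'⟩ := hap
    exact ⟨d, hd, by omega, fun i k hik => (h.runs_le hAne hBne hik (by omega)).trans (by omega),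
      fun i k hik => (h.swap.runs_le hBne hAne hik (by omega)).trans (by omega)⟩
  · have hnap : ∀ k, ¬ ∃ d : ZMod p, d ≠ 0 ∧ runs (dil (a k) C) d ≤ 1 := by
      rintro k ⟨d, hd, hd'⟩
      rw [runs_dil (h.ne_zero k)] at hd'
      exact hap ⟨_, mul_ne_zero (inv_ne_zero (h.ne_zero k)) hd, hd'⟩
    have hav := h.avoids 0 1 2 (by decide) (by decide) (by decide)
    have hle' := hav.rotate.rotate.card_add_le
    rw [add_comm (dil (a 2) C), card_dil (h.ne_zero 1)] at hle'
    obtain ⟨d, hd, hd'⟩ := exists_runs_le_two (dil_nonempty.2 hCne) (C := dil (a 2) C)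
      (X := dil (a 0) A) (fun d hd => by
        by_contra hlt
        exact hnap 2 ⟨d, hd, by omega⟩) (by rw [card_dil (h.ne_zero 0)]; exact hA)
      (by rw [card_dil (h.ne_zero 0), card_dil (h.ne_zero 2)]; omega)
      (by rw [card_dil (h.ne_zero 0), card_dil (h.ne_zero 2)]; omega)
      (by rw [card_dil (h.ne_zero 2)]; omega)
    rw [runs_dil (h.ne_zero 2)] at hd'
    set s := (a 2)⁻¹ * d with hs
    have hs0 : s ≠ 0 := mul_ne_zero (inv_ne_zero (h.ne_zero 2)) hd
    have key : ∀ X Y, IsRainbowFree a b X Y C → 2 ≤ #X → 2 ≤ #Y → ∀ i k, i ≠ k →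
        runs X ((a i)⁻¹ * (a k * s)) ≤ 2 := by
      intro X Y hh hX hY i k hik
      obtain ⟨j, hij, hjk, h1⟩ := hh.avoids' hik
      rw [← runs_dil (h.ne_zero i)]
      refine (runs_le_two_of_sumAvoids h1 ?_ ?_ ?_ ?_ (mul_ne_zero (h.ne_zero k) hs0) ?_).resolve_left
        (hnap k)
      · rw [card_dil (h.ne_zero i), card_dil (h.ne_zero j), card_dil (h.ne_zero k), hh.card_eq]
      · rwa [card_dil (h.ne_zero i)]
      · rwa [card_dil (h.ne_zero j)]
      · rwa [card_dil (h.ne_zero k)]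
      · rwa [runs_dil (h.ne_zero k), inv_mul_cancel_left₀ (h.ne_zero k)]
    exact ⟨s, hs0, hd', key A B h hA (by omega), key B A h.swap (by omega) hA⟩

theorem false_of_seven_le (h : IsRainbowFree a b A B C) (hne : ∃ i j, a i ≠ a j) (hp : 17 ≤ p)
    (hA : 3 ≤ #A) (hAB : #A ≤ #B) (hBC : #B ≤ #C) (hB : 4 ≤ #B) : False := by
  have hcard := h.card_eq
  have hAne : A.Nonempty := card_pos.1 (by omega)
  have hBne : B.Nonempty := card_pos.1 (by omega)
  have hCne : C.Nonempty := card_pos.1 (by omega)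
  obtain ⟨s, hs, hCs, hrA, hrB⟩ := h.exists_step (by omega) hAB (by omega) (by omega)
  have hsq : ∀ i j, a i ^ 2 = a j ^ 2 := by
    by_cases hB5 : 5 ≤ #B
    · exact sq_eq_of_runs_ratio_le_two h.ne_zero (by omega) hs hB5 (by omega) hrB
    -- A four-element `B` is too small for the test with two runs. Passing from `B` to `C` costs one
    -- run and yields products of two ratios.
    · refine sq_eq_of_runs_ratio_le_three h.ne_zero hp hs (S := C) (by omega) (by omega) hCs ?_
      intro i k i' k' hik hik'
      have h1 := hrB i' k' hik'
      exact (h.rotate.rotate.runs_le hCne hAne hik (by omega)).trans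
        (by omega)
  have h01 : (0 : Fin 3) ≠ 1 := by decide
  refine h.false_of_sq_eq hsq hne hs (by omega) (by omega) (by omega) ?_ ?_ hCs
  · rw [← runs_ratio_of_sq_eq (h.ne_zero 0) (hsq 0 1)]; exact hrA 0 1 h01
  · rw [← runs_ratio_of_sq_eq (h.ne_zero 0) (hsq 0 1)]; exact hrB 0 1 h01

end IsRainbowFree

end

/-! ### Three-element sets with a small sumset -/

section

variable {p : ℕ} [Fact p.Prime] {b s : ZMod p} {a : Fin 3 → ZMod p} {A B C X Y : Finset (ZMod p)}

theorem SumAvoids.add_subset (h : SumAvoids b X Y C) : X + Y ⊆ Cᶜ.image (b - ·) := by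
  intro v hv
  obtain ⟨x, hx, y, hy, rfl⟩ := mem_add.1 hv
  refine mem_image.2 ⟨b - (x + y), ?_, by ring⟩
  rw [mem_compl]
  exact fun hc => h x hx y hy _ hc (by ring)

/-- A set of three elements which is not an arithmetic progression meets each of its proper
translates in at most one point. -/
theorem translatesMeetOnce_of_card_three (hX : #X = 3) (h : ∀ d : ZMod p, d ≠ 0 → 2 ≤ runs X d) :
    TranslatesMeetOnce X := by
  intro t ht
  have h1 := h (-t) (neg_ne_zero.2 ht)
  have h2 : #{x ∈ X | x + -t ∉ X} + #{x ∈ X | x + -t ∈ X} = #X := by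
    rw [add_comm]; exact card_filter_add_card_filter_not _
  unfold runs at h1
  have h3 : X ∩ X.image (· + t) ⊆ {x ∈ X | x + -t ∈ X} := by
    intro x hx
    obtain ⟨hx, hx'⟩ := mem_inter.1 hx
    obtain ⟨y, hy, rfl⟩ := mem_image.1 hx'
    rw [mem_filter, add_neg_cancel_right]
    exact ⟨hx, hy⟩
  have := card_le_card h3
  omega

/-- Two triples with shared differences are translates unless one is a progression or a reflection
of the other; `ht` excludes the reflection. -/
theorem eq_add_of_differences {x₁ x₂ x₃ y₁ y₂ y₃ : ZMod p} (h2 : (2 : ZMod p) ≠ 0)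
    (hx12 : x₁ ≠ x₂) (hx23 : x₂ ≠ x₃) (hx31 : x₃ ≠ x₁)
    (hy12 : y₁ ≠ y₂) (hy23 : y₂ ≠ y₃) (hy31 : y₃ ≠ y₁)
    (ha1 : y₁ + y₂ ≠ 2 * y₃) (ha2 : y₂ + y₃ ≠ 2 * y₁) (ha3 : y₃ + y₁ ≠ 2 * y₂)
    (e12 : y₁ - y₂ = x₁ - x₂)
    (e23 : ∃ u ∈ ({x₁, x₂, x₃} : Finset (ZMod p)), ∃ v ∈ ({x₁, x₂, x₃} : Finset (ZMod p)),
      y₂ - y₃ = u - v)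
    (e31 : ∃ u ∈ ({x₁, x₂, x₃} : Finset (ZMod p)), ∃ v ∈ ({x₁, x₂, x₃} : Finset (ZMod p)),
      y₃ - y₁ = u - v)
    (ht : ¬ (x₂ + y₁ = x₁ + y₂ ∧ x₁ + y₂ = x₃ + y₃)) :
    y₂ - y₁ = x₂ - x₁ ∧ y₃ - y₁ = x₃ - x₁ := by
  have hne : ∀ x y : ZMod p, x ≠ y → 2 * x ≠ 2 * y := fun x y hxy h => hxy (mul_left_cancel₀ h2 h)
  have k12 := hne _ _ hx12
  have k23 := hne _ _ hx23
  have k31 := hne _ _ hx31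
  obtain ⟨u, hu, v, hv, e23⟩ := e23
  obtain ⟨u', hu', v', hv', e31⟩ := e31
  simp only [mem_insert, mem_singleton] at hu hv hu' hv'
  clear hne
  rcases hu with rfl | rfl | rfl <;> rcases hv with rfl | rfl | rfl <;>
    rcases hu' with rfl | rfl | rfl <;> rcases hv' with rfl | rfl | rfl <;> grind

theorem runs_le_one_of_add_eq {x y z : ZMod p} (h : x + y = 2 * z) :
    runs ({x, z, y} : Finset (ZMod p)) (y - z) ≤ 1 := by
  refine (card_le_card (t := {y}) fun w hw => ?_).trans_eq (card_singleton y)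
  simp only [mem_filter, mem_insert, mem_singleton, not_or] at hw ⊢
  obtain ⟨rfl | rfl | rfl, h1, h2, h3⟩ := hw
  · exact absurd (by linear_combination h) h2
  · exact absurd (by ring) h3
  · rfl

set_option maxHeartbeats 800000 in
-- `X + Y` is a union of three translates of `X` that pairwise meet at most once. With only six
-- points available, each pair meets exactly once and there is no triple point, so every difference
-- of `Y` is a difference of `X`.
theorem exists_translate (hp2 : p ≠ 2) (hX : #X = 3) (hY : #Y = 3) (hXt : TranslatesMeetOnce X)
    (hYr : ∀ d : ZMod p, d ≠ 0 → 2 ≤ runs Y d) (h : #(X + Y) ≤ 6) :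
    ∃ t, Y = X.image (· + t) := by
  have h2 : (2 : ZMod p) ≠ 0 := by
    intro h0
    have hd : p ∣ 2 := (ZMod.natCast_eq_zero_iff 2 p).1 (by exact_mod_cast h0)
    exact hp2 ((Nat.prime_dvd_prime_iff_eq Fact.out Nat.prime_two).1 hd)
  obtain ⟨y₁, y₂, y₃, hy12, hy13, hy23, rfl⟩ := card_eq_three.1 hY
  have nap : ∀ x y z : ZMod p, ({x, z, y} : Finset (ZMod p)) = {y₁, y₂, y₃} → y ≠ z →
      x + y ≠ 2 * z := by
    intro x y z e hyz hh
    have h1 := runs_le_one_of_add_eq hh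
    have h2 := hYr _ (sub_ne_zero.2 hyz)
    rw [e] at h1
    omega
  have i12 := hXt.card_inter_le hy12
  have i13 := hXt.card_inter_le hy13
  have i23 := hXt.card_inter_le hy23
  have c1 := card_image_add X y₁
  have c2 := card_image_add X y₂
  have c3 := card_image_add X y₃
  have hm : ∀ {t x}, x ∈ X.image (· + t) → ∃ u ∈ X, u + t = x := fun hx => mem_image.1 hx
  set P := X.image (· + y₁)
  set Q := X.image (· + y₂)
  set R := X.image (· + y₃)
  have hsub : P ∪ Q ∪ R ⊆ X + {y₁, y₂, y₃} := by
    refine union_subset (union_subset ?_ ?_) ?_ <;> intro w hw <;> obtain ⟨u, hu, rfl⟩ := hm hw <;>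
      exact add_mem_add hu (by simp)
  have hle := (card_le_card hsub).trans h
  have u1 := card_union_add_card_inter (P ∪ Q) R
  have u2 := card_union_add_card_inter P Q
  have u3 := card_union_add_card_inter (P ∩ R) (Q ∩ R)
  rw [← union_inter_distrib_right] at u3
  have hPQ : 0 < #(P ∩ Q) := by omega
  have hPR : 0 < #(P ∩ R) := by omega
  have hQR : 0 < #(Q ∩ R) := by omega
  have hPQR : #(P ∩ R ∩ (Q ∩ R)) = 0 := by omega
  obtain ⟨w, hw⟩ := card_pos.1 hPQ
  obtain ⟨hwP, hwQ⟩ := mem_inter.1 hw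
  obtain ⟨x₂, hx2, ex2⟩ := hm hwP
  obtain ⟨x₁, hx1, ex1⟩ := hm hwQ
  obtain ⟨v, hv⟩ := card_pos.1 hPR
  obtain ⟨hvP, hvR⟩ := mem_inter.1 hv
  obtain ⟨u₁, hu1, eu1⟩ := hm hvP
  obtain ⟨u₃, hu3, eu3⟩ := hm hvR
  obtain ⟨z, hz⟩ := card_pos.1 hQR
  obtain ⟨hzQ, hzR⟩ := mem_inter.1 hz
  obtain ⟨v₂, hv2, ev2⟩ := hm hzQ
  obtain ⟨v₃, hv3, ev3⟩ := hm hzR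
  have hx12 : x₁ ≠ x₂ := fun e => hy12 (by rw [e, ← ex2] at ex1; exact (add_left_cancel ex1).symm)
  obtain ⟨x₃, hx3⟩ : ∃ x, X \ {x₁, x₂} = {x} := by
    rw [← card_eq_one, card_sdiff_of_subset (by
      rintro i hi; simp only [mem_insert, mem_singleton] at hi
      rcases hi with rfl | rfl <;> assumption), hX, card_pair hx12]
  have hXe : X = {x₁, x₂, x₃} := by
    ext i
    have := congrArg (i ∈ ·) hx3
    simp only [mem_sdiff, mem_insert, mem_singleton, eq_iff_iff] at this ⊢
    constructor
    · tauto
    · rintro (rfl | rfl | rfl)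
      · exact hx1
      · exact hx2
      · exact (this.2 rfl).1
  have hx3' := hx3 ▸ mem_singleton_self x₃
  simp only [mem_sdiff, mem_insert, mem_singleton, not_or] at hx3'
  have hx3R : x₃ ∈ X := hx3'.1
  have hnt : ¬ (x₂ + y₁ = x₁ + y₂ ∧ x₁ + y₂ = x₃ + y₃) := by
    rintro ⟨e1, e2⟩
    have hR : x₁ + y₂ ∈ R := e2 ▸ mem_image_of_mem _ hx3R
    have hQ : x₁ + y₂ ∈ Q := mem_image_of_mem _ hx1
    have hP : x₁ + y₂ ∈ P := e1 ▸ mem_image_of_mem _ hx2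
    have : x₁ + y₂ ∈ P ∩ R ∩ (Q ∩ R) := by simp only [mem_inter]; tauto
    rw [card_eq_zero.1 hPQR] at this
    exact notMem_empty _ this
  rw [hXe] at hu1 hu3 hv2 hv3
  obtain ⟨e1, e2⟩ := eq_add_of_differences h2 hx12 (Ne.symm hx3'.2.2) hx3'.2.1 hy12 hy23 hy13.symm
    (nap y₁ y₂ y₃ (by ext; simp only [mem_insert, mem_singleton]; tauto) hy23) (nap y₂ y₃ y₁ (by ext; simp only [mem_insert, mem_singleton]; tauto) hy13.symm)
    (nap y₃ y₁ y₂ (by ext; simp only [mem_insert, mem_singleton]; tauto) hy12)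
    (by linear_combination ex2 - ex1)
    ⟨v₃, hv3, v₂, hv2, by linear_combination ev2 - ev3⟩
    ⟨u₁, hu1, u₃, hu3, by linear_combination eu3 - eu1⟩ hnt
  refine ⟨y₁ - x₁, ?_⟩
  rw [hXe, image_insert, image_insert, image_singleton, add_sub_cancel,
    show x₂ + (y₁ - x₁) = y₂ by linear_combination -e1,
    show x₃ + (y₁ - x₁) = y₃ by linear_combination -e2]

end

/-! ### Classes of two or three elements -/

section

variable {p : ℕ} [Fact p.Prime] {b s : ZMod p} {a : Fin 3 → ZMod p} {A B C X Y : Finset (ZMod p)}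

namespace IsRainbowFree

/-- Here `a i A + a j B` has four elements and therefore fills the reflected complement of `a k C`.
Exchanging `i` and `j` gives the same set; if `a i ² ≠ a j ²`, comparing first and second moments
gives `A` and `B` equal sums and equal sums of squares, so they would coincide. -/
theorem sq_eq_of_forall_ne {x₁ x₂ y₁ y₂ : ZMod p} (h : IsRainbowFree a b {x₁, x₂} {y₁, y₂} C)
    (hp2 : p ≠ 2) (hx : x₁ ≠ x₂) (hy : y₁ ≠ y₂) (hne : ∀ i j, i ≠ j →
      a i * (x₁ - x₂) ≠ a j * (y₁ - y₂) ∧ a i * (x₁ - x₂) ≠ - (a j * (y₁ - y₂))) (i j : Fin 3) :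
    a i ^ 2 = a j ^ 2 := by
  have h2 : (2 : ZMod p) ≠ 0 := by
    intro h0
    have hd : p ∣ 2 := (ZMod.natCast_eq_zero_iff 2 p).1 (by exact_mod_cast h0)
    exact hp2 ((Nat.prime_dvd_prime_iff_eq Fact.out Nat.prime_two).1 hd)
  have hcard := h.card_eq
  rw [card_pair hx, card_pair hy] at hcard
  have key : ∀ i j k, i ≠ j → i ≠ k → j ≠ k → ∀ f : ZMod p → ZMod p,
      f (a i * x₁ + a j * y₁) + (f (a i * x₁ + a j * y₂) + (f (a i * x₂ + a j * y₁) +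
        f (a i * x₂ + a j * y₂))) = ∑ z ∈ (dil (a k) C)ᶜ.image (b - ·), f z := by
    intro i j k hij hik hjk f
    have hsub := (h.avoids i j k hij hik hjk).add_subset
    have hi := h.ne_zero i
    have hj := h.ne_zero j
    obtain ⟨n1, n2⟩ := hne i j hij
    have hle : #((dil (a k) C)ᶜ.image (b - ·)) ≤ 4 := by
      refine card_image_le.trans ?_
      rw [card_compl, card_dil (h.ne_zero k), ZMod.card]
      omega
    set S : Finset (ZMod p) := {a i * x₁ + a j * y₁, a i * x₁ + a j * y₂, a i * x₂ + a j * y₁,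
      a i * x₂ + a j * y₂} with hS
    have hS' : S ⊆ dil (a i) {x₁, x₂} + dil (a j) {y₁, y₂} := by
      intro z hz
      simp only [hS, mem_insert, mem_singleton] at hz
      rcases hz with rfl | rfl | rfl | rfl <;>
        exact add_mem_add (mem_image_of_mem _ (by simp)) (mem_image_of_mem _ (by simp))
    have d1 : a i * x₁ + a j * y₁ ≠ a i * x₁ + a j * y₂ := fun e =>
      hy (mul_left_cancel₀ hj (add_left_cancel e))
    have d2 : a i * x₁ + a j * y₁ ≠ a i * x₂ + a j * y₁ := fun e =>
      hx (mul_left_cancel₀ hi (add_right_cancel e))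
    have d3 : a i * x₁ + a j * y₁ ≠ a i * x₂ + a j * y₂ := fun e => n2 (by linear_combination e)
    have d4 : a i * x₁ + a j * y₂ ≠ a i * x₂ + a j * y₁ := fun e => n1 (by linear_combination e)
    have d5 : a i * x₁ + a j * y₂ ≠ a i * x₂ + a j * y₂ := fun e =>
      hx (mul_left_cancel₀ hi (add_right_cancel e))
    have d6 : a i * x₂ + a j * y₁ ≠ a i * x₂ + a j * y₂ := fun e =>
      hy (mul_left_cancel₀ hj (add_left_cancel e))
    have m1 : a i * x₁ + a j * y₁ ∉ ({a i * x₁ + a j * y₂, a i * x₂ + a j * y₁,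
      a i * x₂ + a j * y₂} : Finset (ZMod p)) := by
      simp only [mem_insert, mem_singleton, not_or]; exact ⟨d1, d2, d3⟩
    have m2 : a i * x₁ + a j * y₂ ∉ ({a i * x₂ + a j * y₁, a i * x₂ + a j * y₂} :
      Finset (ZMod p)) := by
      simp only [mem_insert, mem_singleton, not_or]; exact ⟨d4, d5⟩
    have hcS : #S = 4 := by rw [hS, card_insert_of_notMem m1, card_insert_of_notMem m2, card_pair d6]
    rw [← eq_of_subset_of_card_le (hS'.trans hsub) (by omega), hS, sum_insert m1, sum_insert m2,
      sum_pair d6]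
  by_cases hij : i = j
  · rw [hij]
  by_contra hsq
  obtain ⟨k, hik, hjk⟩ : ∃ k : Fin 3, i ≠ k ∧ j ≠ k := by
    clear key hne hsq; revert i j; decide
  have hd : a i - a j ≠ 0 := sub_ne_zero.2 fun e => hsq (by rw [e])
  have f1 := (key i j k hij hik hjk id).trans (key j i k (Ne.symm hij) hjk hik id).symm
  have f2 := (key i j k hij hik hjk (· ^ 2)).trans
    (key j i k (Ne.symm hij) hjk hik (· ^ 2)).symm
  simp only [id] at f1
  have g1 : x₁ + x₂ = y₁ + y₂ := by
    refine mul_left_cancel₀ (mul_ne_zero h2 hd) ?_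
    linear_combination f1
  have g2 : x₁ ^ 2 + x₂ ^ 2 = y₁ ^ 2 + y₂ ^ 2 := by
    refine mul_left_cancel₀ (mul_ne_zero h2 (sub_ne_zero.2 hsq)) ?_
    linear_combination f2
  have g3 : (y₁ - x₁) * (y₁ - x₂) = 0 := by
    refine mul_left_cancel₀ h2 ?_
    linear_combination (x₁ + x₂ - 2 * y₁ + y₁ + y₂) * g1 - g2
  have hdis := disjoint_left.1 h.disjoint₁₂
  rcases mul_eq_zero.1 g3 with e | e
  · exact hdis (a := x₁) (by simp) (by rw [sub_eq_zero.1 e]; simp)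
  · exact hdis (a := x₂) (by simp) (by rw [sub_eq_zero.1 e]; simp)

/-- If `a i * (x₁ - x₂) = a j * (y₁ - y₂)`, three terms of an arithmetic progression avoid `C`. -/
theorem exists_progression {x₁ x₂ y₁ y₂ : ZMod p} (h : IsRainbowFree a b {x₁, x₂} {y₁, y₂} C)
    {i j k : Fin 3} (hij : i ≠ j) (hik : i ≠ k) (hjk : j ≠ k)
    (e : a i * (x₁ - x₂) = a j * (y₁ - y₂)) :
    ∃ x, ∀ n ≤ 2, x + ((n : ℕ) : ZMod p) * ((a k)⁻¹ * (a i * (x₁ - x₂))) ∉ C := by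
  have hk := h.ne_zero k
  have hav : ∀ x ∈ ({x₁, x₂} : Finset (ZMod p)), ∀ y ∈ ({y₁, y₂} : Finset (ZMod p)),
      (a k)⁻¹ * (b - (a i * x + a j * y)) ∉ C := by
    intro x hx y hy hc
    refine h.avoids i j k hij hik hjk _ (mem_image_of_mem _ hx) _ (mem_image_of_mem _ hy) _
      (mem_image_of_mem _ hc) ?_
    rw [mul_inv_cancel_left₀ hk]; ring
  refine ⟨(a k)⁻¹ * (b - (a i * x₁ + a j * y₁)), fun n hn => ?_⟩
  interval_cases n
  · simpa using hav x₁ (by simp) y₁ (by simp)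
  · refine fun hc => hav x₂ (by simp) y₁ (by simp) ?_
    convert hc using 1; push_cast; ring
  · refine fun hc => hav x₂ (by simp) y₂ (by simp) ?_
    convert hc using 1; push_cast; linear_combination -(a k)⁻¹ * e

/-- If the four sums are always distinct, moments apply. Otherwise a coincidence puts three
consecutive terms outside `C`, which replaces the size condition on the complement in the smallness
test: four missing points are too few for it. -/
theorem false_of_card_two (h : IsRainbowFree a b A B C) (hne : ∃ i j, a i ≠ a j) (hp : 11 ≤ p)
    (hA : #A = 2) (hB : #B = 2) : False := by
  have hcard := h.card_eq
  have hAne : A.Nonempty := card_pos.1 (by omega)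
  have hBne : B.Nonempty := card_pos.1 (by omega)
  have hCne : C.Nonempty := card_pos.1 (by omega)
  have step : ∀ X Y, IsRainbowFree a b X Y C → #X = 2 → #Y = 2 → ∀ x y, X = {x, y} → x ≠ y →
      runs X (x - y) ≤ 1 ∧ ∀ i k, i ≠ k → runs C ((a i)⁻¹ * (a k * (x - y))) ≤ 2 := by
    intro X Y hh hX hY x y hXe hxy
    have hX1 : runs X (x - y) ≤ 1 := by
      refine (card_le_card (t := {x}) fun w hw => ?_).trans_eq (card_singleton x)
      rw [hXe] at hw
      simp only [mem_filter, mem_insert, mem_singleton, not_or] at hw ⊢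
      obtain ⟨rfl | rfl, h1, h2⟩ := hw
      · rfl
      · exact absurd (by ring) h1
    exact ⟨hX1, fun i k hik => (hh.swap.rotate.rotate.runs_le hCne (card_pos.1 (by omega)) hik
      (by omega)).trans (by omega)⟩
  obtain ⟨x₁, x₂, hx, hAe⟩ := card_eq_two.1 hA
  obtain ⟨y₁, y₂, hy, hBe⟩ := card_eq_two.1 hB
  obtain ⟨hA1, hCA⟩ := step A B h hA hB x₁ x₂ hAe hx
  obtain ⟨-, hCB⟩ := step B A h.swap hB hA y₁ y₂ hBe hy
  obtain ⟨-, hCB'⟩ := step B A h.swap hB hA y₂ y₁ (hBe.trans (pair_comm _ _)) hy.symm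
  have hx' : x₁ - x₂ ≠ 0 := sub_ne_zero.2 hx
  have core : ∀ {y₁ y₂ : ZMod p}, B = {y₁, y₂} → y₁ ≠ y₂ →
      (∀ i k, i ≠ k → runs C ((a i)⁻¹ * (a k * (y₁ - y₂))) ≤ 2) → ∀ i j, i ≠ j →
      a i * (x₁ - x₂) = a j * (y₁ - y₂) → ∀ i j, a i ^ 2 = a j ^ 2 := by
    intro y₁ y₂ hBe hy hCB i j hij e
    obtain ⟨k, hik, hjk⟩ : ∃ k : Fin 3, i ≠ k ∧ j ≠ k := by
      clear e; revert i j; decide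
    have hi := h.ne_zero i
    have hj := h.ne_zero j
    have hk := h.ne_zero k
    have hy' : y₁ - y₂ ≠ 0 := sub_ne_zero.2 hy
    have h' := h
    rw [hAe, hBe] at h'
    have hprog := h'.exists_progression hij hik hjk e
    set σ := (a k)⁻¹ * (a i * (x₁ - x₂)) with hσ
    have hσ' : σ = (a k)⁻¹ * (a j * (y₁ - y₂)) := by rw [hσ, e]
    have hσ0 : σ ≠ 0 := mul_ne_zero (inv_ne_zero hk) (mul_ne_zero hi hx')
    have hσr : runs C σ ≤ 2 := hCA k i hik.symm
    have kA : ∀ l m, l ≠ m → IsSmall 2 ((a l)⁻¹ * (a m * (x₁ - x₂)) / σ) := fun l m hlm =>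
      isSmall_div_of_runs_le (by norm_num) hσ0
        (mul_ne_zero (inv_ne_zero (h.ne_zero l)) (mul_ne_zero (h.ne_zero m) hx')) hσr
        (hCA l m hlm) (by omega) (Or.inr hprog)
    have kB : ∀ l m, l ≠ m → IsSmall 2 ((a l)⁻¹ * (a m * (y₁ - y₂)) / σ) := fun l m hlm =>
      isSmall_div_of_runs_le (by norm_num) hσ0
        (mul_ne_zero (inv_ne_zero (h.ne_zero l)) (mul_ne_zero (h.ne_zero m) hy')) hσr
        (hCB l m hlm) (by omega) (Or.inr hprog)
    have q1 : a k ^ 2 = a j ^ 2 := by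
      refine sq_eq_sq_of_div hj (sq_eq_one_of_isSmall_two hp ?_ ?_)
      · convert kA j i hij.symm using 1; rw [hσ]; field_simp
      · convert kB j k hjk using 1; rw [hσ']; field_simp
    have q2 : a k ^ 2 = a i ^ 2 := by
      refine sq_eq_sq_of_div hi (sq_eq_one_of_isSmall_two hp ?_ ?_)
      · convert kB i j hij using 1; rw [hσ']; field_simp
      · convert kA i k hik using 1; rw [hσ]; field_simp
    have q : ∀ l, a l ^ 2 = a k ^ 2 := by
      intro l
      have : l = i ∨ l = j ∨ l = k := by
        clear e kA kB q1 q2 hprog hσ' hσ0 hσr hσ σ hi hj hk; revert l i j k; decide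
      rcases this with rfl | rfl | rfl
      · exact q2.symm
      · exact q1.symm
      · rfl
    exact fun l m => (q l).trans (q m).symm
  have hsq : ∀ i j, a i ^ 2 = a j ^ 2 := by
    by_cases hc : ∀ i j, i ≠ j →
      a i * (x₁ - x₂) ≠ a j * (y₁ - y₂) ∧ a i * (x₁ - x₂) ≠ - (a j * (y₁ - y₂))
    · have h' := h
      rw [hAe, hBe] at h'
      exact h'.sq_eq_of_forall_ne (by omega) hx hy hc
    · push Not at hc
      obtain ⟨i, j, hij, hc⟩ := hc
      by_cases e : a i * (x₁ - x₂) = a j * (y₁ - y₂)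
      · exact core hBe hy hCB i j hij e
      · exact core (hBe.trans (pair_comm _ _)) hy.symm hCB' i j hij
          ((hc e).trans (by ring))
  refine h.false_of_sq_eq hsq hne hx' hA.ge hB.ge (by omega) (by omega)
    ((runs_le_card _ _).trans hB.le) ?_
  rw [← runs_ratio_of_sq_eq (h.ne_zero 0) (hsq 0 1)]
  exact hCA 0 1 (by decide)

/-- Neither `A` nor `B` is a progression, so `a i A + a j B` has exactly six elements and `a j B` is
a translate of `a i A` for all `i ≠ j`. Chaining these gives `B = A + t`. Comparing `a i A + a j B`
with `a j A + a i B`, the set `a i A + a j A` has period `(a i - a j) t`, impossible with at most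
nine elements. -/
theorem false_of_card_three (h : IsRainbowFree a b A B C) (hne : ∃ i j, a i ≠ a j) (hp : 11 ≤ p)
    (hA : #A = 3) (hB : #B = 3) : False := by
  have hcard := h.card_eq
  have hrA : ∀ d : ZMod p, d ≠ 0 → 2 ≤ runs A d := fun d hd => by
    by_contra hlt
    exact h.false_of_arithmetic hne hp (by omega) (by omega) (by omega) (by omega) hd (by omega)
  have hrB : ∀ d : ZMod p, d ≠ 0 → 2 ≤ runs B d := fun d hd => by
    by_contra hlt
    exact h.swap.false_of_arithmetic hne hp (by omega) (by omega) (by omega) (by omega) hd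
      (by omega)
  have hdr : ∀ {X : Finset (ZMod p)} (i : Fin 3), (∀ d : ZMod p, d ≠ 0 → 2 ≤ runs X d) →
      ∀ d : ZMod p, d ≠ 0 → 2 ≤ runs (dil (a i) X) d := by
    intro X i hX d hd
    rw [runs_dil (h.ne_zero i)]
    exact hX _ (mul_ne_zero (inv_ne_zero (h.ne_zero i)) hd)
  have hc : ∀ {X : Finset (ZMod p)} (i : Fin 3), #(dil (a i) X) = #X := fun i =>
    card_dil (h.ne_zero i) _
  have htA : ∀ i, TranslatesMeetOnce (dil (a i) A) := fun i =>
    translatesMeetOnce_of_card_three ((hc i).trans hA) (hdr i hrA)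
  have hsum : ∀ i j k, i ≠ j → i ≠ k → j ≠ k → dil (a i) A + dil (a j) B =
      (dil (a k) C)ᶜ.image (b - ·) := by
    intro i j k hij hik hjk
    refine eq_of_subset_of_card_le (h.avoids i j k hij hik hjk).add_subset ?_
    have h1 := (htA i).card_add_bound (dil (a j) B) 1
    rw [hc, hc, hA, hB] at h1
    have h2 : #((dil (a k) C)ᶜ.image (b - ·)) ≤ 6 := by
      refine card_image_le.trans ?_
      rw [card_compl, hc, ZMod.card]
      omega
    omega
  have htr : ∀ i j, i ≠ j → ∃ t, dil (a j) B = (dil (a i) A).image (· + t) := by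
    intro i j hij
    obtain ⟨k, hik, hjk⟩ : ∃ k : Fin 3, i ≠ k ∧ j ≠ k := by revert i j; decide
    refine exists_translate (by omega) ((hc i).trans hA) ((hc j).trans hB) (htA i) (hdr j hrB) ?_
    rw [hsum i j k hij hik hjk]
    refine card_image_le.trans ?_
    rw [card_compl, hc, ZMod.card]
    omega
  obtain ⟨i, j, hij⟩ := hne
  have hij' : i ≠ j := fun e => hij (by rw [e])
  obtain ⟨k, hik, hjk⟩ : ∃ k : Fin 3, i ≠ k ∧ j ≠ k := by
    clear hij; revert i j; decide
  obtain ⟨t₁, e₁⟩ := htr i j hij'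
  obtain ⟨t₂, e₂⟩ := htr k j hjk.symm
  obtain ⟨t₃, e₃⟩ := htr k i hik.symm
  have hi := h.ne_zero i
  have hBA : B = A.image (· + (a i)⁻¹ * (t₁ - t₂ + t₃)) := by
    ext x
    have m1 := fun y => congrArg (y ∈ ·) e₁
    have m2 := fun y => congrArg (y ∈ ·) e₂
    have m3 := congrArg (a i * x ∈ ·) e₃
    have himg : ∀ (S : Finset (ZMod p)) (t y : ZMod p), y ∈ S.image (· + t) ↔ y - t ∈ S := by
      intro S t y
      rw [mem_image]
      exact ⟨fun ⟨z, hz, e⟩ => by rw [← e, add_sub_cancel_right]; exact hz,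
        fun hz => ⟨_, hz, sub_add_cancel _ _⟩⟩
    simp only [himg, mem_dil hi, mem_dil (h.ne_zero j), mem_dil (h.ne_zero k), eq_iff_iff] at m1 m2 m3
    rw [inv_mul_cancel_left₀ hi] at m3
    rw [himg, m3]
    have m2' := m2 (a i * x - t₃ + t₂)
    have m1' := m1 (a i * x - t₃ + t₂)
    rw [add_sub_cancel_right] at m2'
    rw [← m2', m1']
    have : (a i)⁻¹ * (a i * x - t₃ + t₂ - t₁) = x - (a i)⁻¹ * (t₁ - t₂ + t₃) := by
      field_simp; ring
    rw [this]
  set t := (a i)⁻¹ * (t₁ - t₂ + t₃)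
  have hdil : ∀ l, dil (a l) B = dil (a l) A + {a l * t} := by
    intro l
    rw [hBA, image_add_right_eq, dil, dil, image_image, image_image]
    congr 1; ext x; simp only [Function.comp]; ring
  have hs1 := (hsum i j k hij' hik hjk).trans (hsum j i k hij'.symm hjk hik).symm
  rw [hdil, hdil] at hs1
  by_cases ht : t = 0
  · have : B = A := by rw [hBA, ht]; simp
    have hd := h.disjoint₁₂
    rw [this, disjoint_self_iff_empty] at hd
    rw [hd] at hA; simp at hA
  · set U := dil (a i) A + dil (a j) A with hU
    have hUne : U.Nonempty := by
      have hAne : A.Nonempty := card_pos.1 (by omega)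
      exact (dil_nonempty.2 hAne).add (dil_nonempty.2 hAne)
    have hUcard : #U ≤ 9 := card_add_le.trans (by rw [hc, hc, hA])
    have hd : (a i - a j) * t ≠ 0 := mul_ne_zero (sub_ne_zero.2 hij) ht
    have hUuniv : U = univ := by
      refine eq_univ_of_forall_add_mem hd hUne fun x hx => ?_
      obtain ⟨u, hu, v, hv, rfl⟩ := mem_add.1 hx
      have : v + (u + a i * t) ∈ dil (a j) A + (dil (a i) A + {a i * t}) :=
        add_mem_add hv (add_mem_add hu (mem_singleton_self _))
      rw [← hs1] at this
      obtain ⟨u', hu', w, hw, e⟩ := mem_add.1 this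
      obtain ⟨v', hv', z, hz, rfl⟩ := mem_add.1 hw
      rw [mem_singleton] at hz
      rw [hU, show u + v + (a i - a j) * t = u' + v' by rw [hz] at e; linear_combination -e]
      exact add_mem_add hu' hv'
    rw [hUuniv, card_univ, ZMod.card] at hUcard
    omega

/-- For `p ≥ 17`, some class of a rainbow-free colouring has at most one element. -/
theorem false_of_two_le (h : IsRainbowFree a b A B C) (hne : ∃ i j, a i ≠ a j) (hp : 17 ≤ p)
    (hA : 2 ≤ #A) (hAB : #A ≤ #B) (hBC : #B ≤ #C) : False := by
  have hcard := h.card_eq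
  rcases (show #A = 2 ∨ 3 ≤ #A by omega) with hA2 | hA3
  · rcases (show #B = 2 ∨ 3 ≤ #B by omega) with hB2 | hB3
    · exact h.false_of_card_two hne (by omega) hA2 hB2
    · obtain ⟨x, y, hxy, hAe⟩ := card_eq_two.1 hA2
      refine h.false_of_arithmetic hne (by omega) hA (by omega) (by omega) (by omega)
        (sub_ne_zero.2 hxy) ?_
      refine (card_le_card (t := {x}) fun w hw => ?_).trans_eq (card_singleton x)
      rw [hAe] at hw
      simp only [mem_filter, mem_insert, mem_singleton, not_or] at hw ⊢
      obtain ⟨rfl | rfl, h1, h2⟩ := hw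
      · rfl
      · exact absurd (by ring) h1
  · rcases (show #B = 3 ∨ 4 ≤ #B by omega) with hB3 | hB4
    · exact h.false_of_card_three hne (by omega) (by omega) hB3
    · exact h.false_of_seven_le hne hp hA3 hAB hBC hB4

end IsRainbowFree

end

/-- `v`, `y`, `z` in some order solve `x₁ + α x₂ + β x₃ ≡ b` modulo `p`. -/
def solvesInSomeOrder (p α β b v y z : ℕ) : Bool :=
  (v + α * y + β * z) % p == b || (v + α * z + β * y) % p == b || (y + α * v + β * z) % p == b ||
  (z + α * v + β * y) % p == b || (y + α * z + β * v) % p == b || (z + α * y + β * v) % p == b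

/-- `v` is in a solution together with a member of `Y` and a member of `Z`. -/
def conflicts (p α β b v : ℕ) (Y Z : List ℕ) : Bool :=
  Y.any fun y => Z.any fun z => solvesInSomeOrder p α β b v y z

/-- Every extension of the partial colouring with classes `L₀`, `L₁`, `L₂` to the list either has a
rainbow solution or a class with at most one element. -/
def noExtension (p α β b : ℕ) : List ℕ → List ℕ → List ℕ → List ℕ → Bool
  | [], L₀, L₁, L₂ => L₀.tail.isEmpty || L₁.tail.isEmpty || L₂.tail.isEmpty
  | v :: vs, L₀, L₁, L₂ =>
    (conflicts p α β b v L₁ L₂ || noExtension p α β b vs (v :: L₀) L₁ L₂) &&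
    (conflicts p α β b v L₀ L₂ || noExtension p α β b vs L₀ (v :: L₁) L₂) &&
    (conflicts p α β b v L₀ L₁ || noExtension p α β b vs L₀ L₁ (v :: L₂))

/-- The search over the place `w` of a third colour, when `0` and `1` have the other two. -/
def noColouringFrom (p α β b : ℕ) : List ℕ → List ℕ → Bool
  | _, [] => true
  | pre, w :: post =>
    (conflicts p α β b w [0] [1] ||
      noExtension p α β b (pre.reverseAux post) [0] [1] [w]) &&
    noColouringFrom p α β b (w :: pre) post

/-- The search over all equations `x₁ + α x₂ + β x₃ = b`, where `b = 0` unless `1 + α + β = 0`. -/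
def noColouring (p : ℕ) (l : List ℕ) : Bool :=
  (1 :: l).all fun α => (1 :: l).all fun β => Nat.blt β α || (α == 1 && β == 1) ||
    if (1 + α + β) % p == 0 then (0 :: 1 :: l).all fun b => noColouringFrom p α β b [] l
    else noColouringFrom p α β 0 [] l

/-- Only 7, 11 and 13 need a search: three classes of at least two elements require `p ≥ 6`, and `p
≥ 17` is covered by the general argument. -/
theorem noColouring_seven : noColouring 7 [2, 3, 4, 5, 6] = true := by decide +kernel

theorem noColouring_eleven : noColouring 11 [2, 3, 4, 5, 6, 7, 8, 9, 10] = true := by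
  decide +kernel

theorem noColouring_thirteen : noColouring 13 [2, 3, 4, 5, 6, 7, 8, 9, 10, 11, 12] = true := by
  decide +kernel

/-! ### Soundness of the finite search -/

section

variable {p α β b : ℕ} {c : ℕ → Fin 3}

theorem conflicts_eq_false (hc : ∀ x y z, (x + α * y + β * z) % p = b → c x ≠ c y → c x ≠ c z →
    c y ≠ c z → False) {v : ℕ} {Y Z : List ℕ} {k l m : Fin 3} (hkl : k ≠ l) (hkm : k ≠ m)
    (hlm : l ≠ m) (hv : c v = k) (hY : ∀ y ∈ Y, c y = l) (hZ : ∀ z ∈ Z, c z = m) :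
    conflicts p α β b v Y Z = false := by
  rw [conflicts, List.any_eq_false]
  intro y hy
  rw [Bool.not_eq_true, List.any_eq_false]
  intro z hz h
  have ey := hY y hy
  have ez := hZ z hz
  rw [← hv, ← ey] at hkl
  rw [← hv, ← ez] at hkm
  rw [← ey, ← ez] at hlm
  simp only [solvesInSomeOrder, Bool.or_eq_true, beq_iff_eq] at h
  rcases h with ((((h | h) | h) | h) | h) | h
  · exact hc _ _ _ h hkl hkm hlm
  · exact hc _ _ _ h hkm hkl hlm.symm
  · exact hc _ _ _ h hkl.symm hlm hkm
  · exact hc _ _ _ h hkm.symm hlm.symm hkl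
  · exact hc _ _ _ h hlm hkl.symm hkm.symm
  · exact hc _ _ _ h hlm.symm hkm.symm hkl.symm

theorem eq_of_tail_isEmpty {L : List ℕ} (h : L.tail.isEmpty = true) : ∃ x, ∀ v ∈ L, v = x := by
  match L, h with
  | [], _ => exact ⟨0, by simp⟩
  | [x], _ => exact ⟨x, by simp⟩

theorem exists_class_of_noExtension (hc : ∀ x y z, (x + α * y + β * z) % p = b → c x ≠ c y →
    c x ≠ c z → c y ≠ c z → False) (vs : List ℕ) : ∀ L₀ L₁ L₂ : List ℕ,
    (∀ v ∈ L₀, c v = 0) → (∀ v ∈ L₁, c v = 1) → (∀ v ∈ L₂, c v = 2) →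
    noExtension p α β b vs L₀ L₁ L₂ = true →
    ∃ k x, ∀ v, v ∈ vs ∨ v ∈ L₀ ∨ v ∈ L₁ ∨ v ∈ L₂ → c v = k → v = x := by
  induction vs with
  | nil =>
    intro L₀ L₁ L₂ h0 h1 h2 h
    simp only [noExtension, Bool.or_eq_true] at h
    rcases h with (h | h) | h <;> obtain ⟨x, hx⟩ := eq_of_tail_isEmpty h
    · refine ⟨0, x, fun v hv hk => ?_⟩
      rcases hv with hv | hv | hv | hv
      · simp at hv
      · exact hx v hv
      · rw [h1 v hv] at hk; exact absurd hk (by decide)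
      · rw [h2 v hv] at hk; exact absurd hk (by decide)
    · refine ⟨1, x, fun v hv hk => ?_⟩
      rcases hv with hv | hv | hv | hv
      · simp at hv
      · rw [h0 v hv] at hk; exact absurd hk (by decide)
      · exact hx v hv
      · rw [h2 v hv] at hk; exact absurd hk (by decide)
    · refine ⟨2, x, fun v hv hk => ?_⟩
      rcases hv with hv | hv | hv | hv
      · simp at hv
      · rw [h0 v hv] at hk; exact absurd hk (by decide)
      · rw [h1 v hv] at hk; exact absurd hk (by decide)
      · exact hx v hv
  | cons u vs ih =>
    intro L₀ L₁ L₂ h0 h1 h2 h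
    simp only [noExtension, Bool.and_eq_true, Bool.or_eq_true] at h
    obtain ⟨⟨k0, k1⟩, k2⟩ := h
    have hcons : ∀ {L : List ℕ} {k : Fin 3}, (∀ v ∈ L, c v = k) → c u = k →
        ∀ v ∈ u :: L, c v = k := fun hL hu => List.forall_mem_cons.2 ⟨hu, hL⟩
    rcases (show c u = 0 ∨ c u = 1 ∨ c u = 2 by generalize c u = k; revert k; decide) with
      hu | hu | hu
    · rw [conflicts_eq_false hc (by decide) (by decide) (by decide) hu h1 h2] at k0
      obtain ⟨k, x, hx⟩ := ih _ _ _ (hcons h0 hu) h1 h2 (k0.resolve_left (by decide))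
      refine ⟨k, x, fun v hv => hx v ?_⟩
      simp only [List.mem_cons] at hv ⊢; tauto
    · rw [conflicts_eq_false hc (by decide) (by decide) (by decide) hu h0 h2] at k1
      obtain ⟨k, x, hx⟩ := ih _ _ _ h0 (hcons h1 hu) h2 (k1.resolve_left (by decide))
      refine ⟨k, x, fun v hv => hx v ?_⟩
      simp only [List.mem_cons] at hv ⊢; tauto
    · rw [conflicts_eq_false hc (by decide) (by decide) (by decide) hu h0 h1] at k2
      obtain ⟨k, x, hx⟩ := ih _ _ _ h0 h1 (hcons h2 hu) (k2.resolve_left (by decide))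
      refine ⟨k, x, fun v hv => hx v ?_⟩
      simp only [List.mem_cons] at hv ⊢; tauto

theorem exists_class_of_noColouringFrom (hc : ∀ x y z, (x + α * y + β * z) % p = b → c x ≠ c y →
    c x ≠ c z → c y ≠ c z → False) (h0 : c 0 = 0) (h1 : c 1 = 1) (post : List ℕ) :
    ∀ pre, noColouringFrom p α β b pre post = true → (∃ w ∈ post, c w = 2) →
    ∃ k x, ∀ v, v ∈ pre ∨ v ∈ post ∨ v = 0 ∨ v = 1 → c v = k → v = x := by
  induction post with
  | nil => rintro pre - ⟨w, hw, -⟩; simp at hw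
  | cons w post ih =>
    rintro pre h ⟨w', hw', h2⟩
    simp only [noColouringFrom, Bool.and_eq_true, Bool.or_eq_true] at h
    by_cases hw : c w = 2
    · rw [conflicts_eq_false hc (k := 2) (l := 0) (m := 1) (by decide) (by decide) (by decide) hw
        (by simpa using h0) (by simpa using h1)] at h
      obtain ⟨k, x, hx⟩ := exists_class_of_noExtension hc _ _ _ _ (by simpa using h0)
        (by simpa using h1) (by simpa using hw) (h.1.resolve_left (by decide))
      refine ⟨k, x, fun v hv => hx v ?_⟩
      simp only [List.reverseAux_eq, List.mem_append, List.mem_reverse, List.mem_cons,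
        List.not_mem_nil, or_false] at hv ⊢
      tauto
    · have hw2 : w' ∈ post := by
        rcases List.mem_cons.1 hw' with rfl | h'
        · exact absurd h2 hw
        · exact h'
      obtain ⟨k, x, hx⟩ := ih _ h.2 ⟨w', hw2, h2⟩
      refine ⟨k, x, fun v hv => hx v ?_⟩
      simp only [List.mem_cons] at hv ⊢
      tauto

end

/-! ### Normalisation for the small primes and the bound on class sizes -/

namespace IsRainbowFree

variable {p : ℕ} [Fact p.Prime] {b : ZMod p} {a : Fin 3 → ZMod p} {A B C : Finset (ZMod p)}

theorem comp_perm (h : IsRainbowFree a b A B C) (e : Equiv.Perm (Fin 3)) :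
    IsRainbowFree (a ∘ e) b A B C where
  ne_zero i := h.ne_zero (e i)
  avoids i j k hij hik hjk := h.avoids (e i) (e j) (e k) (e.injective.ne hij) (e.injective.ne hik)
    (e.injective.ne hjk)
  disjoint₁₂ := h.disjoint₁₂
  disjoint₁₃ := h.disjoint₁₃
  disjoint₂₃ := h.disjoint₂₃
  cover := h.cover

/-- The colour of `x` for the colouring with classes `A`, `B` and the rest. -/
def colour (A B : Finset (ZMod p)) (x : ZMod p) : Fin 3 := if x ∈ A then 0 else if x ∈ B then 1 else 2

theorem mem_of_colour_eq (h : IsRainbowFree a b A B C) {x : ZMod p} :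
    (colour A B x = 0 → x ∈ A) ∧ (colour A B x = 1 → x ∈ B) ∧ (colour A B x = 2 → x ∈ C) := by
  have := h.cover x
  unfold colour
  split_ifs with h1 h2 <;> simp <;> tauto

theorem colour_eq (h : IsRainbowFree a b A B C) {x : ZMod p} :
    (x ∈ A → colour A B x = 0) ∧ (x ∈ B → colour A B x = 1) ∧ (x ∈ C → colour A B x = 2) := by
  have h1 : x ∈ A → x ∉ B := fun hx => disjoint_left.1 h.disjoint₁₂ hx
  have h2 : x ∈ A → x ∉ C := fun hx => disjoint_left.1 h.disjoint₁₃ hx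
  have h3 : x ∈ B → x ∉ C := fun hx => disjoint_left.1 h.disjoint₂₃ hx
  unfold colour
  split_ifs <;> simp <;> tauto

theorem false_of_colour_ne (h : IsRainbowFree a b A B C) {x y z : ZMod p}
    (e : a 0 * x + a 1 * y + a 2 * z = b) (hxy : colour A B x ≠ colour A B y)
    (hxz : colour A B x ≠ colour A B z) (hyz : colour A B y ≠ colour A B z) : False := by
  obtain ⟨x0, x1, x2⟩ := h.mem_of_colour_eq (x := x)
  obtain ⟨y0, y1, y2⟩ := h.mem_of_colour_eq (x := y)
  obtain ⟨z0, z1, z2⟩ := h.mem_of_colour_eq (x := z)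
  have hav : ∀ i j k : Fin 3, i ≠ j → i ≠ k → j ≠ k → ∀ u ∈ A, ∀ v ∈ B, ∀ w ∈ C,
      a i * u + a j * v + a k * w ≠ b := fun i j k hij hik hjk u hu v hv w hw =>
    h.avoids i j k hij hik hjk _ (mem_image_of_mem _ hu) _ (mem_image_of_mem _ hv) _
      (mem_image_of_mem _ hw)
  have hfin : ∀ k l m : Fin 3, k ≠ l → k ≠ m → l ≠ m → (k = 0 ∧ l = 1 ∧ m = 2) ∨
      (k = 0 ∧ l = 2 ∧ m = 1) ∨ (k = 1 ∧ l = 0 ∧ m = 2) ∨ (k = 1 ∧ l = 2 ∧ m = 0) ∨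
      (k = 2 ∧ l = 0 ∧ m = 1) ∨ (k = 2 ∧ l = 1 ∧ m = 0) := by decide
  rcases hfin _ _ _ hxy hxz hyz with ⟨hx, hy, hz⟩ | ⟨hx, hy, hz⟩ | ⟨hx, hy, hz⟩ | ⟨hx, hy, hz⟩ |
    ⟨hx, hy, hz⟩ | ⟨hx, hy, hz⟩
  · exact hav 0 1 2 (by decide) (by decide) (by decide) _ (x0 hx) _ (y1 hy) _ (z2 hz) e
  · exact hav 0 2 1 (by decide) (by decide) (by decide) _ (x0 hx) _ (z1 hz) _ (y2 hy)
      (by linear_combination e)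
  · exact hav 1 0 2 (by decide) (by decide) (by decide) _ (y0 hy) _ (x1 hx) _ (z2 hz)
      (by linear_combination e)
  · exact hav 2 0 1 (by decide) (by decide) (by decide) _ (z0 hz) _ (x1 hx) _ (y2 hy)
      (by linear_combination e)
  · exact hav 1 2 0 (by decide) (by decide) (by decide) _ (y0 hy) _ (z1 hz) _ (x2 hx)
      (by linear_combination e)
  · exact hav 2 1 0 (by decide) (by decide) (by decide) _ (z0 hz) _ (y1 hy) _ (x2 hx)
      (by linear_combination e)

/-- Dividing by `a 0` and permuting coefficients gives `1, α, β` with `α ≤ β`; an affine change of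
variable puts `0` in the first class and `1` in the second. -/
theorem false_of_noColouring {l : List ℕ} (hl : ∀ v < p, v = 0 ∨ v = 1 ∨ v ∈ l)
    (hs : noColouring p l = true) (h : IsRainbowFree a b A B C) (hne : ∃ i j, a i ≠ a j)
    (hA : 2 ≤ #A) (hB : 2 ≤ #B) (hC : 2 ≤ #C) : False := by
  wlog hle : (a 1 / a 0).val ≤ (a 2 / a 0).val generalizing a
  · refine this (h.comp_perm (Equiv.swap 1 2)) ?_ ?_
    · obtain ⟨i, j, hij⟩ := hne
      exact ⟨Equiv.swap 1 2 i, Equiv.swap 1 2 j, by simpa using hij⟩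
    · have e0 : Equiv.swap (1 : Fin 3) 2 0 = 0 := by decide
      simp only [Function.comp, Equiv.swap_apply_left, Equiv.swap_apply_right, e0]
      omega
  have ha0 := h.ne_zero 0
  set σ := a 0 + a 1 + a 2 with hσ
  -- The origin `o` is the constant solution when the coefficient sum is nonzero, making the new
  -- right-hand side zero; otherwise any origin will do, and every `b` is searched.
  obtain ⟨o, ho⟩ : ∃ o : ZMod p, σ ≠ 0 → b - σ * o = 0 := by
    by_cases h0 : σ = 0
    · exact ⟨0, fun h' => absurd h0 h'⟩
    · exact ⟨σ⁻¹ * b, fun _ => by rw [mul_inv_cancel_left₀ h0, sub_self]⟩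
  wlog hoA : o ∈ A generalizing A B C
  · rcases h.cover o with hx | hx | hx
    · exact hoA hx
    · exact this hB hC hA h.rotate hx
    · exact this hC hA hB h.rotate.rotate hx
  obtain ⟨g₀, hg₀⟩ := card_pos.1 (show 0 < #B by omega)
  obtain ⟨w₀, hw₀⟩ := card_pos.1 (show 0 < #C by omega)
  have hg : g₀ - o ≠ 0 := sub_ne_zero.2 fun e => disjoint_left.1 h.disjoint₁₂ hoA (e ▸ hg₀)
  set g := g₀ - o with hgdef
  set c : ℕ → Fin 3 := fun v => colour A B (o + g * v) with hc
  have hval : ∀ x, o + g * (((x - o) / g).val : ℕ) = x := by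
    intro x
    rw [ZMod.natCast_zmod_val]
    field_simp
    ring
  have hcval : ∀ x, c ((x - o) / g).val = colour A B x := fun x => by
    simp only [hc]
    rw [hval]
  have h0 : c 0 = 0 := by
    simp only [hc, Nat.cast_zero, mul_zero, add_zero]
    exact h.colour_eq.1 hoA
  have h1 : c 1 = 1 := by
    simp only [hc, Nat.cast_one, mul_one, hgdef, add_sub_cancel]
    exact h.colour_eq.2.1 hg₀
  have hvl : ∀ x : ZMod p, x.val = 0 ∨ x.val = 1 ∨ x.val ∈ l := fun x => hl _ (ZMod.val_lt x)
  have hw2 : ∃ w ∈ l, c w = 2 := by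
    have h2 := (hcval w₀).trans (h.colour_eq.2.2 hw₀)
    rcases hvl ((w₀ - o) / g) with e | e | e
    · rw [e, h0] at h2; exact absurd h2 (by decide)
    · rw [e, h1] at h2; exact absurd h2 (by decide)
    · exact ⟨_, e, h2⟩
  set α := a 1 / a 0 with hα
  set β := a 2 / a 0 with hβ
  set b' := (b - σ * o) / (a 0 * g) with hb'
  have hfree : ∀ x y z, (x + α.val * y + β.val * z) % p = b'.val → c x ≠ c y → c x ≠ c z →
      c y ≠ c z → False := by
    intro x y z e
    refine h.false_of_colour_ne ?_
    have e' := congrArg (Nat.cast : ℕ → ZMod p) e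
    rw [ZMod.natCast_mod] at e'
    push_cast at e'
    rw [ZMod.natCast_zmod_val, ZMod.natCast_zmod_val, ZMod.natCast_zmod_val, hα, hβ, hb', hσ] at e'
    field_simp at e'
    linear_combination e'
  have hnz : ∀ x : ZMod p, x ≠ 0 → x.val ∈ 1 :: l := fun x hx => by
    rw [List.mem_cons]
    exact (hvl x).resolve_left (by rwa [ZMod.val_eq_zero])
  have hαβ : ¬ (α.val = 1 ∧ β.val = 1) := by
    rintro ⟨e1, e2⟩
    have k1 : α = 1 := by rw [← ZMod.natCast_zmod_val α, e1, Nat.cast_one]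
    have k2 : β = 1 := by rw [← ZMod.natCast_zmod_val β, e2, Nat.cast_one]
    rw [hα, div_eq_one_iff_eq ha0] at k1
    rw [hβ, div_eq_one_iff_eq ha0] at k2
    obtain ⟨i, j, hij⟩ := hne
    have : ∀ i, a i = a 0 := by
      intro i; fin_cases i
      · rfl
      · exact k1
      · exact k2
    exact hij ((this i).trans (this j).symm)
  have hfrom : noColouringFrom p α.val β.val b'.val [] l = true := by
    simp only [noColouring, List.all_eq_true, Bool.or_eq_true, Bool.and_eq_true, beq_iff_eq] at hs
    have h3 := hs _ (hnz α (div_ne_zero (h.ne_zero 1) ha0)) _ (hnz β (div_ne_zero (h.ne_zero 2) ha0))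
    have h4 := h3.resolve_left (by
      rintro (h5 | h5)
      · rw [Nat.blt_eq] at h5; omega
      · exact hαβ h5)
    split_ifs at h4 with h5
    · rw [List.all_eq_true] at h4
      refine h4 _ ?_
      simp only [List.mem_cons]
      exact hvl b'
    · have hσ0 : σ ≠ 0 := by
        intro e
        refine h5 ?_
        rw [← Nat.dvd_iff_mod_eq_zero, ← ZMod.natCast_eq_zero_iff]
        push_cast
        rw [ZMod.natCast_zmod_val, ZMod.natCast_zmod_val, hα, hβ]
        field_simp
        rw [mul_zero]
        exact e
      have : b' = 0 := by rw [hb', ho hσ0, zero_div]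
      rwa [this, ZMod.val_zero]
  obtain ⟨k, x, hx⟩ := exists_class_of_noColouringFrom hfree h0 h1 l [] hfrom hw2
  have hcl : ∀ X : Finset (ZMod p), 2 ≤ #X → ¬ ∀ u ∈ X, colour A B u = k := by
    intro X hX hXk
    obtain ⟨u, hu, v, hv, huv⟩ := one_lt_card.1 hX
    have key : ∀ u ∈ X, ((u - o) / g).val = x := fun u hu => hx _ (by
      rcases hvl ((u - o) / g) with e | e | e <;> tauto) ((hcval u).trans (hXk u hu))
    refine huv ?_
    rw [← hval u, ← hval v, key u hu, key v hv]
  rcases (show k = 0 ∨ k = 1 ∨ k = 2 by clear hx hcl; revert k; decide) with rfl | rfl | rfl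
  · exact hcl A hA fun u hu => h.colour_eq.1 hu
  · exact hcl B hB fun u hu => h.colour_eq.2.1 hu
  · exact hcl C hC fun u hu => h.colour_eq.2.2 hu

/-- Some class of a rainbow-free colouring has at most one element. -/
theorem false_of_two_le_card (h : IsRainbowFree a b A B C) (hne : ∃ i j, a i ≠ a j)
    (hA : 2 ≤ #A) (hB : 2 ≤ #B) (hC : 2 ≤ #C) : False := by
  by_cases hp : 17 ≤ p
  · wlog hAB : #A ≤ #B generalizing A B C
    · exact this h.swap hB hA hC (by omega)
    by_cases hBC : #B ≤ #C
    · exact h.false_of_two_le hne hp hA hAB hBC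
    by_cases hAC : #A ≤ #C
    · exact h.swap.rotate.false_of_two_le hne hp hA hAC (by omega)
    · exact h.rotate.rotate.false_of_two_le hne hp hC (by omega) hAB
  · have hcard := h.card_eq
    have hpr : p.Prime := Fact.out
    have : p = 7 ∨ p = 11 ∨ p = 13 := by
      have h6 : 6 ≤ p := by omega
      interval_cases p <;> revert hpr <;> norm_num
    rcases this with rfl | rfl | rfl
    · exact h.false_of_noColouring (by decide) noColouring_seven hne hA hB hC
    · exact h.false_of_noColouring (by decide) noColouring_eleven hne hA hB hC
    · exact h.false_of_noColouring (by decide) noColouring_thirteen hne hA hB hC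

end IsRainbowFree

/-! ### Singleton classes -/

namespace IsRainbowFree

variable {p : ℕ} [Fact p.Prime] {b u : ZMod p} {a : Fin 3 → ZMod p} {A B C : Finset (ZMod p)}

theorem sum_eq_of_ne {i j k : Fin 3} (hij : i ≠ j) (hik : i ≠ k) (hjk : j ≠ k) (a : Fin 3 → ZMod p) :
    a 0 + a 1 + a 2 = a i + a j + a k := by
  fin_cases i <;> fin_cases j <;> fin_cases k <;> simp at hij hik hjk ⊢ <;> ring

/-- The third member of a solution through the singleton class and `C` is not in `B`. -/
theorem eq_or_mem_of_solution (h : IsRainbowFree a b {u} B C) {i j k : Fin 3} (hij : i ≠ j) (hik : i ≠ k)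
    (hjk : j ≠ k) {x y : ZMod p} (e : a i * y + a j * x + a k * u = b) (hx : x ∈ C) :
    y = u ∨ y ∈ C := by
  rcases h.cover y with hy | hy | hy
  · exact Or.inl (mem_singleton.1 hy)
  · exact absurd (by linear_combination e) (h.avoids k i j hik.symm hjk.symm hij _
      (mem_image_of_mem _ (mem_singleton_self u)) _ (mem_image_of_mem _ hy) _
      (mem_image_of_mem _ hx))
  · exact Or.inr hy

/-- Solving for one variable with another in `C` and the third equal to `u` maps `C` into itself,
since by `hw` the value `u` never arises. -/
theorem false_of_forall_notMem (h : IsRainbowFree a b {u} B C) (hC : C.Nonempty)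
    (hne : ∃ i j, a i ≠ a j) (hτ : (a 0 + a 1 + a 2) * u ≠ b)
    (hw : ∀ j, u + (b - (a 0 + a 1 + a 2) * u) / a j ∉ C) : False := by
  set τ := b - (a 0 + a 1 + a 2) * u with hτdef
  have hτ0 : τ ≠ 0 := sub_ne_zero.2 (Ne.symm hτ)
  have hφ : ∀ i j, i ≠ j → ∀ z, u + z ∈ C → u + (τ - a j * z) / a i ∈ C := by
    intro i j hij z hz
    obtain ⟨k, hik, hjk⟩ : ∃ k : Fin 3, i ≠ k ∧ j ≠ k := by clear hw; revert i j; decide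
    have hi := h.ne_zero i
    have hj := h.ne_zero j
    rcases h.eq_or_mem_of_solution hij hik hjk (y := u + (τ - a j * z) / a i) (by
      rw [hτdef, sum_eq_of_ne hij hik hjk]; field_simp; ring) hz with e | e
    · rw [add_eq_left, div_eq_zero_iff, or_iff_left hi, sub_eq_zero] at e
      refine absurd hz ?_
      convert hw j using 3
      rw [e]; field_simp
    · exact e
  -- Three such maps compose to a reflection. Reflections for two different coefficients compose to
  -- a nonzero translation, so `C` would be everything.
  have hρ : ∀ i z, u + z ∈ C → u + (τ / a i - z) ∈ C := by
    intro i z hz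
    obtain ⟨j, k, hij, hik, hjk⟩ : ∃ j k : Fin 3, i ≠ j ∧ i ≠ k ∧ j ≠ k := by
      clear hw; revert i; decide
    have hi := h.ne_zero i
    have hj := h.ne_zero j
    have hk := h.ne_zero k
    convert hφ i k hik _ (hφ k j hjk.symm _ (hφ j i hij.symm _ hz)) using 2
    field_simp
    ring
  obtain ⟨i, j, hij⟩ := hne
  have hi := h.ne_zero i
  have hj := h.ne_zero j
  have hd : τ / a i - τ / a j ≠ 0 := by
    rw [sub_ne_zero]
    intro e
    rw [div_eq_div_iff hi hj] at e
    exact hij (mul_left_cancel₀ hτ0 e).symm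
  have hu := eq_univ_of_forall_add_mem hd hC fun x hx => by
    have := hρ i _ (hρ j (x - u) (by rwa [add_sub_cancel]))
    convert this using 1
    ring
  exact disjoint_left.1 h.disjoint₁₃ (mem_singleton_self u) (hu ▸ mem_univ u)

/-- A singleton class of a rainbow-free colouring is a constant solution. -/
theorem sum_mul_eq (h : IsRainbowFree a b {u} B C) (hB : B.Nonempty) (hC : C.Nonempty)
    (hne : ∃ i j, a i ≠ a j) : (a 0 + a 1 + a 2) * u = b := by
  by_contra hτ
  set τ := b - (a 0 + a 1 + a 2) * u with hτdef
  have hτ0 : τ ≠ 0 := sub_ne_zero.2 (Ne.symm hτ)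
  -- If `u + τ / a j` is outside `C`, the map `φ` permutes `C`. But `φ u = u + τ / a i` and `u ∉ C`.
  -- Hence the points `u + τ / a j` all avoid `C` or all avoid `B`.
  have hsame : ∀ B C, IsRainbowFree a b {u} B C → ∀ i j, u + τ / a i ∈ C → u + τ / a j ∈ C := by
    intro B C h i j hi
    by_contra hj
    have hij : i ≠ j := by rintro rfl; exact hj hi
    obtain ⟨k, hik, hjk⟩ : ∃ k : Fin 3, i ≠ k ∧ j ≠ k := by clear hi hj; revert i j; decide
    have hai := h.ne_zero i
    have haj := h.ne_zero j
    set φ : ZMod p → ZMod p := fun x => u + (τ - a j * (x - u)) / a i with hφ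
    have hinj : Function.Injective φ := by
      intro x y e
      simp only [hφ, add_right_inj, div_left_inj' hai, sub_right_inj] at e
      exact sub_left_injective (mul_left_cancel₀ haj e)
    have hmap : C.image φ ⊆ C := by
      intro y hy
      obtain ⟨x, hx, rfl⟩ := mem_image.1 hy
      rcases h.eq_or_mem_of_solution hij hik hjk (y := φ x) (by
        rw [hφ, hτdef, sum_eq_of_ne hij hik hjk]; field_simp; ring) hx with e | e
      · rw [hφ, add_eq_left, div_eq_zero_iff, or_iff_left hai, sub_eq_zero] at e
        refine absurd hx ?_
        convert hj using 2
        rw [e]; field_simp; ring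
      · exact e
    have heq := eq_of_subset_of_card_le hmap (card_image_of_injective _ hinj).ge
    rw [← heq] at hi
    obtain ⟨x, hx, e⟩ := mem_image.1 hi
    have hxu : x = u := hinj (e.trans (by simp [hφ]))
    exact disjoint_left.1 h.disjoint₁₃ (mem_singleton_self u) (hxu ▸ hx)
  have hBC : IsRainbowFree a b {u} C B := h.swap.rotate
  by_cases hw : ∀ j, u + τ / a j ∉ C
  · exact h.false_of_forall_notMem hC hne hτ hw
  · push Not at hw
    obtain ⟨i, hi⟩ := hw
    refine hBC.false_of_forall_notMem hB hne hτ fun j hj => ?_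
    exact disjoint_left.1 h.disjoint₂₃ hj (hsame B C h i j hi)

theorem smul_mem (h : IsRainbowFree a b {u} B C) (hu : (a 0 + a 1 + a 2) * u = b) {i j : Fin 3}
    (hij : i ≠ j) {x : ZMod p} (hx : x ∈ C) : u + -a j * (a i)⁻¹ * (x - u) ∈ C := by
  obtain ⟨k, hik, hjk⟩ : ∃ k : Fin 3, i ≠ k ∧ j ≠ k := by revert i j; decide
  have hi := h.ne_zero i
  have hj := h.ne_zero j
  refine (h.eq_or_mem_of_solution hij hik hjk ?_ hx).resolve_left fun e => ?_
  · rw [← hu, sum_eq_of_ne hij hik hjk]; field_simp; ring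
  · rw [add_eq_left, mul_eq_zero, sub_eq_zero] at e
    refine disjoint_left.1 h.disjoint₁₃ (mem_singleton_self u) (e.resolve_left ?_ ▸ hx)
    exact mul_ne_zero (neg_ne_zero.2 hj) (inv_ne_zero hi)

/-- A second singleton `{v}` must be fixed by every ratio, so `a i = -a j` for all `i ≠ j`, which is
impossible for three nonzero coefficients in odd characteristic. -/
theorem false_of_card_eq_one (h : IsRainbowFree a b A B C) (hp : p ≠ 2) (hne : ∃ i j, a i ≠ a j)
    (hA : #A = 1) (hB : #B = 1) (hC : C.Nonempty) : False := by
  have h2 : (2 : ZMod p) ≠ 0 := by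
    intro h0
    have hd : p ∣ 2 := (ZMod.natCast_eq_zero_iff 2 p).1 (by exact_mod_cast h0)
    exact hp ((Nat.prime_dvd_prime_iff_eq Fact.out Nat.prime_two).1 hd)
  obtain ⟨u, rfl⟩ := card_eq_one.1 hA
  obtain ⟨v, rfl⟩ := card_eq_one.1 hB
  have hu := h.sum_mul_eq (singleton_nonempty v) hC hne
  have hvu : v - u ≠ 0 := sub_ne_zero.2 fun e => disjoint_left.1 h.disjoint₁₂
    (mem_singleton_self u) (mem_singleton.2 e.symm)
  have key : ∀ i j, i ≠ j → a i = - a j := by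
    intro i j hij
    have hi := h.ne_zero i
    have h' : IsRainbowFree a b {u} C {v} := h.swap.rotate
    have e := mem_singleton.1 (h'.smul_mem hu hij (mem_singleton_self v))
    have : -a j * (a i)⁻¹ = 1 := mul_right_cancel₀ hvu (by linear_combination e)
    rwa [mul_inv_eq_one₀ hi, eq_comm] at this
  have k1 := key 0 1 (by decide)
  have k2 := key 0 2 (by decide)
  have k3 := key 1 2 (by decide)
  exact mul_ne_zero h2 (h.ne_zero 0) (by linear_combination k1 + k2 - k3)

/-- Exactly one class of a rainbow-free colouring is a singleton. -/
theorem card_eq_one_cases (h : IsRainbowFree a b A B C) (hp : p ≠ 2) (hne : ∃ i j, a i ≠ a j)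
    (hA : A.Nonempty) (hB : B.Nonempty) (hC : C.Nonempty) :
    (#A = 1 ∧ #B ≠ 1 ∧ #C ≠ 1) ∨ (#A ≠ 1 ∧ #B = 1 ∧ #C ≠ 1) ∨ (#A ≠ 1 ∧ #B ≠ 1 ∧ #C = 1) := by
  have hA' := card_pos.2 hA
  have hB' := card_pos.2 hB
  have hC' := card_pos.2 hC
  have h0 : ¬ (2 ≤ #A ∧ 2 ≤ #B ∧ 2 ≤ #C) := fun ⟨h1, h2, h3⟩ =>
    h.false_of_two_le_card hne h1 h2 h3
  have h1 : ¬ (#A = 1 ∧ #B = 1) := fun ⟨h1, h2⟩ => h.false_of_card_eq_one hp hne h1 h2 hC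
  have h2 : ¬ (#B = 1 ∧ #C = 1) := fun ⟨h1, h2⟩ => h.rotate.false_of_card_eq_one hp hne h1 h2 hA
  have h3 : ¬ (#C = 1 ∧ #A = 1) := fun ⟨h1, h2⟩ =>
    h.rotate.rotate.false_of_card_eq_one hp hne h1 h2 hB
  omega

end IsRainbowFree

theorem exists_ne_of_not_eq {α : Type*} {a₁ a₂ a₃ : α} (hne : ¬ (a₁ = a₂ ∧ a₂ = a₃)) :
    ∃ i j, ![a₁, a₂, a₃] i ≠ ![a₁, a₂, a₃] j := by
  by_contra! h
  exact hne ⟨h 0 1, h 1 2⟩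

/-! ### Colourings and the rainbow number -/

section

variable {p : ℕ} [Fact p.Prime] {a₁ a₂ a₃ b : ZMod p}

/-- Merging colours through `m` creates no rainbow solution; the merging is needed for four colours.
-/
theorem isRainbowFree_of_colouring {r : ℕ} {c : ZMod p → Fin r} (h1 : a₁ ≠ 0) (h2 : a₂ ≠ 0)
    (h3 : a₃ ≠ 0) (hc : ¬ HasRainbowSolution a₁ a₂ a₃ b c) (m : Fin r → Fin 3) :
    IsRainbowFree ![a₁, a₂, a₃] b {x | m (c x) = 0} {x | m (c x) = 1} {x | m (c x) = 2} where
  ne_zero i := by fin_cases i <;> assumption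
  avoids i j k hij hik hjk := by
    have key : ∀ s₁ s₂ s₃, a₁ * s₁ + a₂ * s₂ + a₃ * s₃ = b → m (c s₁) ≠ m (c s₂) →
        m (c s₁) ≠ m (c s₃) → m (c s₂) ≠ m (c s₃) → False := fun s₁ s₂ s₃ e h12 h13 h23 =>
      hc ⟨s₁, s₂, s₃, e, fun h => h12 (by rw [h]), fun h => h13 (by rw [h]),
        fun h => h23 (by rw [h])⟩
    intro x hx y hy z hz e
    obtain ⟨s, hs, rfl⟩ := mem_image.1 hx
    obtain ⟨t, ht, rfl⟩ := mem_image.1 hy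
    obtain ⟨w, hw, rfl⟩ := mem_image.1 hz
    simp only [mem_filter, mem_univ, true_and] at hs ht hw
    have n1 : m (c s) ≠ m (c t) := by rw [hs, ht]; decide
    have n2 : m (c s) ≠ m (c w) := by rw [hs, hw]; decide
    have n3 : m (c t) ≠ m (c w) := by rw [ht, hw]; decide
    fin_cases i <;> fin_cases j <;> fin_cases k <;> simp at hij hik hjk e
    · exact key s t w e n1 n2 n3
    · exact key s w t (by linear_combination e) n2 n1 n3.symm
    · exact key t s w (by linear_combination e) n1.symm n3 n2
    · exact key w s t (by linear_combination e) n2.symm n3.symm n1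
    · exact key t w s (by linear_combination e) n3 n1.symm n2.symm
    · exact key w t s (by linear_combination e) n3.symm n2.symm n1.symm
  disjoint₁₂ := by
    rw [disjoint_left]; intro x; simp only [mem_filter, mem_univ, true_and]
    intro h h'; rw [h] at h'; exact absurd h' (by decide)
  disjoint₁₃ := by
    rw [disjoint_left]; intro x; simp only [mem_filter, mem_univ, true_and]
    intro h h'; rw [h] at h'; exact absurd h' (by decide)
  disjoint₂₃ := by
    rw [disjoint_left]; intro x; simp only [mem_filter, mem_univ, true_and]
    intro h h'; rw [h] at h'; exact absurd h' (by decide)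
  cover x := by
    simp only [mem_filter, mem_univ, true_and]
    generalize m (c x) = k; revert k; decide

theorem hasRainbowSolution_of_four (hp : p ≠ 2) (h1 : a₁ ≠ 0) (h2 : a₂ ≠ 0) (h3 : a₃ ≠ 0)
    (hne : ¬ (a₁ = a₂ ∧ a₂ = a₃)) {c : ZMod p → Fin 4} (hc : Function.Surjective c) :
    HasRainbowSolution a₁ a₂ a₃ b c := by
  by_contra hno
  -- The merged class of `o` and `o'` has at least two elements, so the unique singleton is `k` or
  -- `l`. This cannot hold for all pairs from three colours.
  have key : ∀ k l o o' : Fin 4, k ≠ l → o ≠ o' → o ≠ k → o ≠ l → o' ≠ k → o' ≠ l →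
      (#{x | c x = k} = 1 ↔ #{x | c x = l} ≠ 1) := by
    intro k l o o' hkl hoo hok hol hok' hol'
    set m : Fin 4 → Fin 3 := fun i => if i = k then 1 else if i = l then 2 else 0 with hm
    have hf := isRainbowFree_of_colouring h1 h2 h3 hno m
    have e1 : ∀ i, m i = 1 ↔ i = k := by
      intro i; simp only [hm]; split_ifs <;> simp_all
    have e2 : ∀ i, m i = 2 ↔ i = l := by
      intro i; simp only [hm]; split_ifs <;> simp_all
    simp only [e1, e2] at hf
    obtain ⟨x, hx⟩ := hc k
    obtain ⟨y, hy⟩ := hc l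
    obtain ⟨z, hz⟩ := hc o
    obtain ⟨z', hz'⟩ := hc o'
    have hzz : z ≠ z' := by rintro rfl; exact hoo (hz.symm.trans hz')
    have h2le : 1 < #{x | m (c x) = 0} := one_lt_card.2 ⟨z, by simp [hz, hm, hok, hol], z',
      by simp [hz', hm, hok', hol'], hzz⟩
    have := hf.card_eq_one_cases hp (exists_ne_of_not_eq hne) (card_pos.1 (by omega))
      ⟨x, by simp [hx]⟩ ⟨y, by simp [hy]⟩
    omega
  have k1 := key 0 1 2 3 (by decide) (by decide) (by decide) (by decide) (by decide) (by decide)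
  have k2 := key 0 2 1 3 (by decide) (by decide) (by decide) (by decide) (by decide) (by decide)
  have k3 := key 1 2 0 3 (by decide) (by decide) (by decide) (by decide) (by decide) (by decide)
  tauto

theorem mem_ratio_set {d : ZMod p} :
    d ∈ ({-a₃ * a₁⁻¹, -a₂ * a₁⁻¹, -a₁ * a₂⁻¹, -a₃ * a₂⁻¹, -a₁ * a₃⁻¹, -a₂ * a₃⁻¹} : Set (ZMod p)) ↔
      ∃ i j : Fin 3, i ≠ j ∧ d = -![a₁, a₂, a₃] j * (![a₁, a₂, a₃] i)⁻¹ := by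
  simp only [Set.mem_insert_iff, Set.mem_singleton_iff]
  constructor
  · rintro (h | h | h | h | h | h)
    · exact ⟨0, 2, by decide, h⟩
    · exact ⟨0, 1, by decide, h⟩
    · exact ⟨1, 0, by decide, h⟩
    · exact ⟨1, 2, by decide, h⟩
    · exact ⟨2, 0, by decide, h⟩
    · exact ⟨2, 1, by decide, h⟩
  · rintro ⟨i, j, hij, h⟩
    fin_cases i <;> fin_cases j <;> simp at hij h <;> simp [h]

/-- `C - u` is invariant under the ratio subgroup; the full unit group would carry a point of `B -
u` to one of `C - u`. -/
theorem IsRainbowFree.ratioSubgroup_ne_top {u : ZMod p} {B C : Finset (ZMod p)}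
    (h : IsRainbowFree ![a₁, a₂, a₃] b {u} B C) (hB : B.Nonempty) (hC : C.Nonempty)
    (hu : (a₁ + a₂ + a₃) * u = b) : ratioSubgroup a₁ a₂ a₃ ≠ ⊤ := by
  intro htop
  have h' : IsRainbowFree ![a₁, a₂, a₃] b {u} C B := h.swap.rotate
  have key : ∀ g ∈ ratioSubgroup a₁ a₂ a₃, ∀ z, u + z ∈ C ↔ u + (g : ZMod p) * z ∈ C := by
    intro g hg
    refine Subgroup.closure_induction (p := fun (g : (ZMod p)ˣ) _ => ∀ z, u + z ∈ C ↔ u + (g : ZMod p) * z ∈ C)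
      ?_ ?_ ?_ ?_ hg
    · intro g hg z
      obtain ⟨i, j, hij, e⟩ := mem_ratio_set.1 hg
      have m1 : u + z ∈ C → u + (g : ZMod p) * z ∈ C := fun hz => by
        have := h.smul_mem hu hij hz
        rwa [← e, add_sub_cancel_left] at this
      have m2 : u + z ∈ B → u + (g : ZMod p) * z ∈ B := fun hz => by
        have := h'.smul_mem hu hij hz
        rwa [← e, add_sub_cancel_left] at this
      refine ⟨m1, fun hz => ?_⟩
      rcases h.cover (u + z) with k | k | k
      · rw [mem_singleton, add_eq_left] at k
        rw [k, mul_zero, add_zero] at hz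
        exact absurd hz (disjoint_left.1 h.disjoint₁₃ (mem_singleton_self u))
      · exact absurd hz (disjoint_left.1 h.disjoint₂₃ (m2 k))
      · exact k
    · intro z; simp
    · intro g g' _ _ hg hg' z
      rw [hg' z, hg, Units.val_mul, mul_assoc]
    · intro g _ hg z
      rw [hg ((g⁻¹ : (ZMod p)ˣ) * z), Units.mul_inv_cancel_left]
  obtain ⟨x, hx⟩ := hB
  obtain ⟨y, hy⟩ := hC
  have hxu : x - u ≠ 0 := sub_ne_zero.2 fun e => disjoint_left.1 h.disjoint₁₂
    (mem_singleton_self u) (e ▸ hx)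
  have hyu : y - u ≠ 0 := sub_ne_zero.2 fun e => disjoint_left.1 h.disjoint₁₃
    (mem_singleton_self u) (e ▸ hy)
  have := (key (Units.mk0 ((y - u) / (x - u)) (div_ne_zero hyu hxu)) (htop ▸ Subgroup.mem_top _)
    (x - u)).2 (by
      rw [Units.val_mk0, div_mul_cancel₀ _ hxu, add_sub_cancel]; exact hy)
  rw [add_sub_cancel] at this
  exact disjoint_left.1 h.disjoint₂₃ hx this

theorem hasRainbowSolution_of_three (hp : p ≠ 2) (h1 : a₁ ≠ 0) (h2 : a₂ ≠ 0) (h3 : a₃ ≠ 0)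
    (hne : ¬ (a₁ = a₂ ∧ a₂ = a₃))
    (hcond : ratioSubgroup a₁ a₂ a₃ = ⊤ ∨ (a₁ + a₂ + a₃ = 0 ∧ b ≠ 0)) {c : ZMod p → Fin 3}
    (hc : Function.Surjective c) : HasRainbowSolution a₁ a₂ a₃ b c := by
  by_contra hno
  have hf := isRainbowFree_of_colouring h1 h2 h3 hno id
  have hn : ∀ k : Fin 3, (({x | id (c x) = k} : Finset (ZMod p))).Nonempty := fun k => by
    obtain ⟨x, hx⟩ := hc k
    exact ⟨x, by simp [hx]⟩
  have hne' := exists_ne_of_not_eq hne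
  have key : ∀ A B C, IsRainbowFree ![a₁, a₂, a₃] b A B C → #A = 1 → B.Nonempty → C.Nonempty →
      False := by
    intro A B C h hA hB hC
    obtain ⟨u, rfl⟩ := card_eq_one.1 hA
    have hu : (a₁ + a₂ + a₃) * u = b := h.sum_mul_eq hB hC hne'
    rcases hcond with ht | ⟨h0, hb⟩
    · exact h.ratioSubgroup_ne_top hB hC hu ht
    · rw [h0, zero_mul] at hu; exact hb hu.symm
  rcases hf.card_eq_one_cases hp hne' (hn 0) (hn 1) (hn 2) with h | h | h
  · exact key _ _ _ hf h.1 (hn 1) (hn 2)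
  · exact key _ _ _ hf.rotate h.2.1 (hn 2) (hn 0)
  · exact key _ _ _ hf.rotate.rotate h.2.2 (hn 0) (hn 1)

/-- The colouring with a constant solution, a translated orbit of the ratio subgroup, and the rest
has no rainbow solution. -/
theorem exists_colouring (h1 : a₁ ≠ 0) (h2 : a₂ ≠ 0) (h3 : a₃ ≠ 0)
    (hH : ratioSubgroup a₁ a₂ a₃ ≠ ⊤) {u : ZMod p} (hu : (a₁ + a₂ + a₃) * u = b) :
    ∃ c : ZMod p → Fin 3, Function.Surjective c ∧ ¬ HasRainbowSolution a₁ a₂ a₃ b c := by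
  classical
  obtain ⟨g, hg⟩ : ∃ g, g ∉ ratioSubgroup a₁ a₂ a₃ := by
    by_contra! h
    exact hH (eq_top_iff.2 fun g _ => h g)
  set P : ZMod p → Prop := fun x => ∃ h ∈ ratioSubgroup a₁ a₂ a₃, x = u + (h : ZMod p) with hP
  set c : ZMod p → Fin 3 := fun x => if x = u then 0 else if P x then 1 else 2 with hc
  have hcu : c u = 0 := by simp [hc]
  have hc0 : ∀ x, c x = 0 → x = u := by
    intro x hx
    by_contra hxu
    simp only [hc, hxu, if_false] at hx
    split_ifs at hx
    all_goals exact absurd hx (by decide)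
  -- A rainbow solution must contain `u`; subtracting the constant solution shows that its other two
  -- members, measured from `u`, differ by a ratio and so share a colour.
  have hstep : ∀ x y, ∀ i j : Fin 3, i ≠ j →
      ![a₁, a₂, a₃] i * (y - u) = - ![a₁, a₂, a₃] j * (x - u) → c x = c y := by
    intro x y i j hij e
    have hnz : ∀ i, ![a₁, a₂, a₃] i ≠ 0 := by intro i; fin_cases i <;> assumption
    have hi := hnz i
    have hj := hnz j
    set d := Units.mk0 (-![a₁, a₂, a₃] j * (![a₁, a₂, a₃] i)⁻¹)
      (mul_ne_zero (neg_ne_zero.2 hj) (inv_ne_zero hi)) with hd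
    have hdm : d ∈ ratioSubgroup a₁ a₂ a₃ :=
      Subgroup.subset_closure (mem_ratio_set.2 ⟨i, j, hij, rfl⟩)
    have e' : y - u = (d : ZMod p) * (x - u) := by
      rw [hd, Units.val_mk0]; field_simp; linear_combination e
    have hxy : x = u ↔ y = u := by
      rw [← sub_eq_zero, ← sub_eq_zero (a := y), e', mul_eq_zero, or_iff_right d.ne_zero]
    have hPxy : P x ↔ P y := by
      constructor
      · rintro ⟨h, hh, rfl⟩
        refine ⟨d * h, mul_mem hdm hh, ?_⟩
        rw [add_sub_cancel_left] at e'
        rw [Units.val_mul, ← e', add_sub_cancel]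
      · rintro ⟨h, hh, rfl⟩
        refine ⟨d⁻¹ * h, mul_mem (inv_mem hdm) hh, ?_⟩
        rw [add_sub_cancel_left] at e'
        rw [Units.val_mul, e', Units.inv_mul_cancel_left, add_sub_cancel]
    simp only [hc, hxy, hPxy]
  refine ⟨c, ?_, ?_⟩
  · intro k
    have hk : k = 0 ∨ k = 1 ∨ k = 2 := by revert k; decide
    rcases hk with rfl | rfl | rfl
    · exact ⟨u, hcu⟩
    · refine ⟨u + 1, ?_⟩
      have : P (u + 1) := ⟨1, one_mem _, by simp⟩
      simp [hc, this]
    · refine ⟨u + g, ?_⟩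
      have : ¬ P (u + g) := by
        rintro ⟨h, hh, e⟩
        exact hg (Units.ext (add_left_cancel e) ▸ hh)
      simp [hc, this]
  · rintro ⟨s₁, s₂, s₃, e, n12, n13, n23⟩
    unfold IsSolution at e
    have h0 : c s₁ = 0 ∨ c s₂ = 0 ∨ c s₃ = 0 := by
      revert n12 n13 n23
      generalize c s₁ = k
      generalize c s₂ = l
      generalize c s₃ = m
      revert k l m
      decide
    rcases h0 with h0 | h0 | h0 <;> have := hc0 _ h0 <;> subst this
    · exact n23 (hstep s₂ s₃ 2 1 (by decide) (by simp; linear_combination e - hu))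
    · exact n13 (hstep s₁ s₃ 2 0 (by decide) (by simp; linear_combination e - hu))
    · exact n12 (hstep s₁ s₂ 1 0 (by decide) (by simp; linear_combination e - hu))

theorem exists_surjective_fin {r : ℕ} (hr : 0 < r) (hrp : r ≤ p) :
    ∃ c : ZMod p → Fin r, Function.Surjective c := by
  refine ⟨fun x => ⟨x.val % r, Nat.mod_lt _ hr⟩, fun k => ⟨(k.val : ZMod p), ?_⟩⟩
  ext
  simp only
  rw [ZMod.val_natCast_of_lt (k.2.trans_le hrp), Nat.mod_eq_of_lt k.2]

theorem three_le_of_forall_hasRainbowSolution {r : ℕ} (hp : 2 ≤ p) (hr : 0 < r)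
    (h : ∀ c : ZMod p → Fin r, Function.Surjective c → HasRainbowSolution a₁ a₂ a₃ b c) :
    3 ≤ r := by
  by_contra hlt
  obtain ⟨c, hc⟩ := exists_surjective_fin (p := p) hr (by omega)
  obtain ⟨s₁, s₂, s₃, -, n12, n13, n23⟩ := h c hc
  simp only [ne_eq, Fin.ext_iff] at n12 n13 n23
  omega

end

theorem mainTheorem2 (p : ℕ) [Fact p.Prime] (hp : 5 ≤ p) (a₁ a₂ a₃ b : ZMod p)
    (hne : ¬ (a₁ = a₂ ∧ a₂ = a₃)) (hunit : IsUnit (a₁ * a₂ * a₃)) :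
    ((Nat.card (ratioSubgroup a₁ a₂ a₃) = p - 1 ∨ (a₁ + a₂ + a₃ = 0 ∧ b ≠ 0)) →
      rainbowNumber a₁ a₂ a₃ b = 3) ∧
    (¬ (Nat.card (ratioSubgroup a₁ a₂ a₃) = p - 1 ∨ (a₁ + a₂ + a₃ = 0 ∧ b ≠ 0)) →
      rainbowNumber a₁ a₂ a₃ b = 4) := by
  have h123 := hunit.ne_zero
  have h12 := left_ne_zero_of_mul h123
  have h1 := left_ne_zero_of_mul h12
  have h2 := right_ne_zero_of_mul h12
  have h3 := right_ne_zero_of_mul h123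
  have hcard : Nat.card (ratioSubgroup a₁ a₂ a₃) = p - 1 ↔ ratioSubgroup a₁ a₂ a₃ = ⊤ := by
    rw [← Subgroup.card_eq_iff_eq_top, Nat.card_eq_fintype_card (α := (ZMod p)ˣ),
      ZMod.card_units]
  rw [hcard]
  refine ⟨fun hcond => IsLeast.csInf_eq ⟨⟨by norm_num, fun c hc => ?_⟩, fun r hr => ?_⟩,
    fun hcond => IsLeast.csInf_eq ⟨⟨by norm_num, fun c hc => ?_⟩, fun r hr => ?_⟩⟩
  · exact hasRainbowSolution_of_three (by omega) h1 h2 h3 hne hcond hc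
  · exact three_le_of_forall_hasRainbowSolution (by omega) hr.1 hr.2
  · exact hasRainbowSolution_of_four (by omega) h1 h2 h3 hne hc
  · have h3r := three_le_of_forall_hasRainbowSolution (by omega) hr.1 hr.2
    by_contra hlt
    obtain rfl : r = 3 := by omega
    push Not at hcond
    -- When the coefficient sum vanishes, the negated condition gives `b = 0`, so any `u` works.
    obtain ⟨u, hu⟩ : ∃ u, (a₁ + a₂ + a₃) * u = b := by
      by_cases h0 : a₁ + a₂ + a₃ = 0
      · exact ⟨0, by rw [hcond.2 h0, mul_zero]⟩
      · exact ⟨_, mul_inv_cancel_left₀ h0 b⟩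
    obtain ⟨c, hc, hno⟩ := exists_colouring h1 h2 h3 hcond.1 hu
    exact hno (hr.2 c hc)
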